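/- Let $\mathbb K$ be either $\mathbb R$ with the usual absolute value, or an ultrametric field, i.e. a field with a non-trivial absolute value satisfying $|x+y|\le\max\{|x|,|y|\}$ (not necessarily complete). Topological $\mathbb K$-vector spaces are assumed Hausdorff, but need not be locally convex. For a map $f:U\to F$ from an open subset $U$ of a topological $\mathbb K$-vector space $E$ to a topological $\mathbb K$-vector space $F$, put $U^{[1]}:=\{(x,y,t)\in U\times E\times\mathbb K : x+ty\in U\}$, an open subset of the topological vector space $E\times E\times\mathbb K$. The map $f$ is of class $C^0$ if it is continuous; it is of class $C^1$ if it is continuous and there is a (necessarily unique) continuous map $f^{[1]}:U^{[1]}\to F$ with $f(x+ty)-f(x)=t\,f^{[1]}(x,y,t)$ for all $(x,y,t)\in U^{[1]}$; and, recursively for $k\ge 1$, it is of class $C^{k+1}$ if it is of class $C^1$ and $f^{[1]}$ is of class $C^k$. It is smooth if it is of class $C^k$ for every $k\in\mathbb N_0$. Theorem. Let $E$ be a metrizable topological $\mathbb K$-vector space, $F$ a topological $\mathbb K$-vector space, $U\subseteq E$ open and $f:U\to F$ a map. Then for each $k\in\mathbb N_0=\{0,1,2,\dots\}$ the following are equivalent: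 (a) $f$ is of class $C^k$; (b) $f\circ c:\mathbb K^{k+1}\to F$ is of class $C^k$ for every smooth map $c:\mathbb K^{k+1}\to U$. In particular, $f$ is smooth if and only if $f\circ c$ is smooth for every integer $k\ge 1$ and every smooth map $c:\mathbb K^k\to U$. -/

import Mathlib

open Topology TopologicalSpace

universe u v w

/-- The set `U^{[1]} = {(x, y, t) | x ∈ U, x + t y ∈ U} ⊆ E × E × 𝕜`. -/
def dqDomain (𝕜 : Type v) {E : Type u} [Field 𝕜] [AddCommGroup E] [Module 𝕜 E] (U : Set E) :
    Set (E × E × 𝕜) :=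
  {p | p.1 ∈ U ∧ p.1 + p.2.2 • p.2.1 ∈ U}

/-- `g` satisfies `f (x + t y) - f x = t g (x, y, t)` for all `(x, y, t) ∈ U^{[1]}`. A continuous
`g` with this property is unique on `U^{[1]}` (for open `U`, Hausdorff range and non-discrete `𝕜`);
it is the difference quotient map `f^{[1]}`. -/
def IsDiffQuot {𝕜 : Type v} {E : Type u} {F : Type w} [Field 𝕜]
    [AddCommGroup E] [Module 𝕜 E] [AddCommGroup F] [Module 𝕜 F]
    (U : Set E) (f : E → F) (g : E × E × 𝕜 → F) : Prop :=
  ∀ x y : E, ∀ t : 𝕜, (x, y, t) ∈ dqDomain 𝕜 U → f (x + t • y) - f x = t • g (x, y, t)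

/-- `f|_U : U → F` is of class `C^k` over `𝕜`: `C^0` means continuous, and `f` is `C^{k+1}` if it is
continuous and has a difference quotient map `f^{[1]}` on `U^{[1]}` which is (continuous and) of
class `C^k`. Only the values of `f` on `U` matter.

The universe of `E` is written `max u v` because `E × E × 𝕜` has to live in the same universe
as `E`. -/
def IsCk (𝕜 : Type v) {F : Type w} [Field 𝕜] [TopologicalSpace 𝕜]
    [AddCommGroup F] [Module 𝕜 F] [TopologicalSpace F] :
    ℕ → ∀ {E : Type (max u v)} [AddCommGroup E] [Module 𝕜 E] [TopologicalSpace E],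
      Set E → (E → F) → Prop
  | 0, _, _, _, _, U, f => ContinuousOn f U
  | k + 1, E, _, _, _, U, f =>
      ContinuousOn f U ∧
        ∃ g : E × E × 𝕜 → F, IsDiffQuot U f g ∧ IsCk 𝕜 k (dqDomain 𝕜 U) g

/-- `f|_U` is smooth, i.e. of class `C^k` for every `k`. -/
def IsSmoothMap (𝕜 : Type v) {F : Type w} [Field 𝕜] [TopologicalSpace 𝕜]
    [AddCommGroup F] [Module 𝕜 F] [TopologicalSpace F]
    {E : Type (max u v)} [AddCommGroup E] [Module 𝕜 E] [TopologicalSpace E]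
    (U : Set E) (f : E → F) : Prop :=
  ∀ k : ℕ, IsCk.{u, v, w} 𝕜 k U f

/-!
That `C^k` maps are detected by composition with smooth maps from `𝕜^{k+1}` is proved by induction
on `k`; the converse is the chain rule `IsCk.comp`.

For `k = 0`, let `f` be discontinuous at `x`. Points `x + v n` with `v n → 0` at which `f` stays
away from `f x` can be chosen so close to `x` that they all lie on a smooth curve `t ↦ x + ∑ h n t
• v n`, where the `h n` are rescaled bumps near points `τ n → 0`. As the space need be neither
locally convex nor complete, smoothness of this curve is checked on the iterated difference
quotients: each of them is again such a sum, with finitely many nonzero terms at each point, and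
with coefficients that are bounded on bounded sets by constants fixed before `v` was chosen
(`isCk_finsum_smul`, `BumpCalculus.continuousOn_of_curves`).

For the step from `k` to `k + 1`, the difference quotient `f^{[1]}` has to be `C^k`, and by
induction this is tested along smooth maps `(c₁, c₂, c₃)` from `𝕜^{k+1}`. Where `c₃` is nonzero,
`f^{[1]}` is an honest quotient. Where `c₃` is small, it is a difference quotient of `(t, s) ↦ f
(c₁ s + t c₂ s)`, which is `C^{k+1}` by hypothesis once a cut-off has made its argument a map into
`U`; this is where the additional parameter is used (`BumpCalculus.isCk_of_comp`).

The field only enters through the bumps and cut-offs, whose properties are collected in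
`BumpCalculus`. Over `ℝ` they come from the usual smooth bump functions, by `f^{[1]} (x, y, t) =
∫₀¹ Df (x + s t y) y ds`. Over an ultrametric field the bump is the indicator function of the unit
ball; since `𝕜` need not be locally compact, boundedness of its iterated difference quotients on
bounded sets is not automatic. It holds since these quotients stay in the explicit algebra
`UltraNice` of bounded-on-bounded-sets functions.
-/

/-! ### Differential calculus over a topological field: closure properties of `C^k` maps -/

section Calculus

universe u' w'

open Set Filter

variable {𝕜 : Type v} [NontriviallyNormedField 𝕜]

/-- The canonical difference quotient of a map: the actual quotient where the scalar `t` is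
nonzero, and the limit of the quotients (a junk value if there is none) where `t = 0`. For a `C^1`
map on an open set it agrees with `f^{[1]}` on `U^{[1]}`, see `IsDiffQuot.dq_eq`. -/
noncomputable def dq (𝕜 : Type v) [NontriviallyNormedField 𝕜] {E : Type*} {F : Type*}
    [AddCommGroup E] [Module 𝕜 E] [AddCommGroup F] [Module 𝕜 F] [TopologicalSpace F]
    (f : E → F) (p : E × E × 𝕜) : F :=
  open Classical in
  if p.2.2 = 0 then
    limUnder (𝓝[≠] (0 : 𝕜)) (fun t => t⁻¹ • (f (p.1 + t • p.2.1) - f p.1))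
  else p.2.2⁻¹ • (f (p.1 + p.2.2 • p.2.1) - f p.1)

section Basic

variable {E : Type*} {F : Type*}
  [AddCommGroup E] [Module 𝕜 E] [AddCommGroup F] [Module 𝕜 F]

theorem mem_dqDomain {U : Set E} {p : E × E × 𝕜} :
    p ∈ dqDomain 𝕜 U ↔ p.1 ∈ U ∧ p.1 + p.2.2 • p.2.1 ∈ U := Iff.rfl

@[simp] theorem dqDomain_univ : dqDomain 𝕜 (univ : Set E) = univ := by
  ext p; simp [mem_dqDomain]

theorem dqDomain_mono {U V : Set E} (h : U ⊆ V) : dqDomain 𝕜 U ⊆ dqDomain 𝕜 V :=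
  fun _ hp => ⟨h hp.1, h hp.2⟩

theorem IsDiffQuot.mono {U V : Set E} {f : E → F} {g : E × E × 𝕜 → F}
    (h : IsDiffQuot V f g) (hUV : U ⊆ V) : IsDiffQuot U f g :=
  fun x y t hp => h x y t (dqDomain_mono hUV hp)

theorem IsDiffQuot.congr {U : Set E} {f f' : E → F} {g : E × E × 𝕜 → F}
    (h : IsDiffQuot U f g) (hf : EqOn f f' U) : IsDiffQuot U f' g := by
  intro x y t hp
  rw [← hf hp.1, ← hf hp.2]
  exact h x y t hp

variable [TopologicalSpace F]

theorem dq_of_ne (f : E → F) (x y : E) {t : 𝕜} (ht : t ≠ 0) :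
    dq 𝕜 f (x, y, t) = t⁻¹ • (f (x + t • y) - f x) := if_neg ht

theorem dq_zero (f : E → F) (x y : E) :
    dq 𝕜 f (x, y, (0 : 𝕜)) =
      limUnder (𝓝[≠] (0 : 𝕜)) (fun t => t⁻¹ • (f (x + t • y) - f x)) := if_pos rfl

theorem isDiffQuot_dq (U : Set E) (f : E → F) : IsDiffQuot U f (dq 𝕜 f) := by
  intro x y t _
  by_cases ht : t = 0
  · simp [ht]
  · rw [dq_of_ne f x y ht, smul_inv_smul₀ ht]

/-- The canonical difference quotient at `(x, y, t)` only depends on the values of the function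
at `x`, at `x + t y`, and at the points `x + τ y` with `τ` near `0`. -/
theorem dq_congr {E' : Type*} [AddCommGroup E'] [Module 𝕜 E'] {f : E → F} {f' : E' → F}
    {x y : E} {x' y' : E'} {t : 𝕜} (h0 : f x = f' x') (ht : f (x + t • y) = f' (x' + t • y'))
    (h : ∀ᶠ τ in 𝓝 (0 : 𝕜), f (x + τ • y) = f' (x' + τ • y')) :
    dq 𝕜 f (x, y, t) = dq 𝕜 f' (x', y', t) := by
  by_cases h' : t = 0
  · subst h'
    rw [dq_zero, dq_zero]
    unfold limUnder
    congr 1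
    apply Filter.map_congr
    filter_upwards [h.filter_mono nhdsWithin_le_nhds] with τ hτ
    rw [hτ, h0]
  · rw [dq_of_ne _ _ _ h', dq_of_ne _ _ _ h', ht, h0]

variable [TopologicalSpace E] [IsTopologicalAddGroup E] [ContinuousSMul 𝕜 E]

theorem isOpen_dqDomain {U : Set E} (hU : IsOpen U) : IsOpen (dqDomain 𝕜 U) :=
  (hU.preimage continuous_fst).inter (hU.preimage
    (continuous_fst.add (continuous_snd.snd.smul continuous_snd.fst) :
      Continuous fun p : E × E × 𝕜 => p.1 + p.2.2 • p.2.1))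

theorem eventually_smul_mem {U : Set E} {x : E}
    (hU : U ∈ 𝓝 x) (y : E) : ∀ᶠ t in 𝓝 (0 : 𝕜), x + t • y ∈ U := by
  have : Continuous fun t : 𝕜 => x + t • y := by fun_prop
  exact this.continuousAt.preimage_mem_nhds (by simpa using hU)

theorem IsDiffQuot.dq_eq [T2Space F] {U : Set E} (hU : IsOpen U) {f : E → F}
    {g : E × E × 𝕜 → F} (h : IsDiffQuot U f g) (hg : ContinuousOn g (dqDomain 𝕜 U)) :
    EqOn g (dq 𝕜 f) (dqDomain 𝕜 U) := by
  rintro ⟨x, y, t⟩ hp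
  by_cases ht : t = 0
  · subst ht
    rw [dq_zero]
    symm
    apply Tendsto.limUnder_eq
    have hx : x ∈ U := hp.1
    have h1 : ContinuousAt g (x, y, 0) := hg.continuousAt ((isOpen_dqDomain hU).mem_nhds hp)
    have h2 : Tendsto (fun τ : 𝕜 => g (x, y, τ)) (𝓝 0) (𝓝 (g (x, y, 0))) :=
      h1.tendsto.comp (Continuous.tendsto (f := fun τ : 𝕜 => (x, y, τ)) (by fun_prop) 0)
    refine (h2.mono_left nhdsWithin_le_nhds).congr' ?_
    filter_upwards [(eventually_smul_mem (hU.mem_nhds hx) y).filter_mono nhdsWithin_le_nhds,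
      self_mem_nhdsWithin] with τ hτ hτ0
    rw [h x y τ ⟨hx, hτ⟩, inv_smul_smul₀ hτ0]
  · rw [dq_of_ne f x y ht, h x y t hp, inv_smul_smul₀ ht]

end Basic

section Ck

variable {F : Type w} [AddCommGroup F] [Module 𝕜 F] [TopologicalSpace F]
  {G : Type w'} [AddCommGroup G] [Module 𝕜 G] [TopologicalSpace G]

theorem IsCk.continuousOn {k : ℕ} {E : Type (max u v)} [AddCommGroup E] [Module 𝕜 E]
    [TopologicalSpace E] {U : Set E} {f : E → F} (h : IsCk.{u, v, w} 𝕜 k U f) :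
    ContinuousOn f U := by
  cases k with
  | zero => exact h
  | succ k => exact h.1

theorem IsCk.congr {k : ℕ} {E : Type (max u v)} [AddCommGroup E] [Module 𝕜 E]
    [TopologicalSpace E] {U : Set E} {f f' : E → F} (h : IsCk.{u, v, w} 𝕜 k U f)
    (hf : EqOn f f' U) : IsCk.{u, v, w} 𝕜 k U f' := by
  cases k with
  | zero => exact ContinuousOn.congr h hf.symm
  | succ k =>
    obtain ⟨hc, g, hg, hgk⟩ := h
    exact ⟨hc.congr hf.symm, g, hg.congr hf, hgk⟩

theorem IsCk.mono : ∀ {k : ℕ} {E : Type (max u v)} [AddCommGroup E] [Module 𝕜 E]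
    [TopologicalSpace E] {U V : Set E} {f : E → F}, IsCk.{u, v, w} 𝕜 k V f → U ⊆ V →
    IsCk.{u, v, w} 𝕜 k U f
  | 0, _, _, _, _, _, _, _, h, hUV => ContinuousOn.mono h hUV
  | _ + 1, _, _, _, _, _, _, _, ⟨hc, g, hg, hgk⟩, hUV =>
    ⟨hc.mono hUV, g, hg.mono hUV, IsCk.mono hgk (dqDomain_mono hUV)⟩

theorem IsCk.of_succ : ∀ {k : ℕ} {E : Type (max u v)} [AddCommGroup E] [Module 𝕜 E]
    [TopologicalSpace E] {U : Set E} {f : E → F}, IsCk.{u, v, w} 𝕜 (k + 1) U f →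
    IsCk.{u, v, w} 𝕜 k U f
  | 0, _, _, _, _, _, _, h => h.1
  | _ + 1, _, _, _, _, _, _, ⟨hc, g, hg, hgk⟩ => ⟨hc, g, hg, IsCk.of_succ hgk⟩

theorem isCk_const : ∀ {k : ℕ} {E : Type (max u v)} [AddCommGroup E] [Module 𝕜 E]
    [TopologicalSpace E] {U : Set E} (c : F), IsCk.{u, v, w} 𝕜 k U (fun _ : E => c)
  | 0, _, _, _, _, _, _ => continuousOn_const
  | _ + 1, _, _, _, _, _, _ =>
    ⟨continuousOn_const, fun _ => 0, fun _ _ _ _ => by simp, isCk_const 0⟩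

theorem ContinuousLinearMap.isCk : ∀ {k : ℕ} {E : Type (max u v)} [AddCommGroup E] [Module 𝕜 E]
    [TopologicalSpace E] {U : Set E} (L : E →L[𝕜] F), IsCk.{u, v, w} 𝕜 k U L
  | 0, _, _, _, _, _, L => L.continuous.continuousOn
  | _ + 1, E, _, _, _, _, L =>
    ⟨L.continuous.continuousOn,
      L ∘L (ContinuousLinearMap.fst 𝕜 E 𝕜 ∘L ContinuousLinearMap.snd 𝕜 E (E × 𝕜)),
      fun x y t _ => by simp, ContinuousLinearMap.isCk _⟩

theorem IsCk.clm_comp : ∀ {k : ℕ} {E : Type (max u v)} [AddCommGroup E] [Module 𝕜 E]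
    [TopologicalSpace E] {U : Set E} {f : E → F} (L : F →L[𝕜] G), IsCk.{u, v, w} 𝕜 k U f →
    IsCk.{u, v, w'} 𝕜 k U (fun x => L (f x))
  | 0, _, _, _, _, _, _, L, h => L.continuous.comp_continuousOn h
  | _ + 1, _, _, _, _, _, _, L, ⟨hc, g, hg, hgk⟩ =>
    ⟨L.continuous.comp_continuousOn hc, fun p => L (g p),
      fun x y t hp => by rw [← map_sub, hg x y t hp, map_smul], hgk.clm_comp L⟩

theorem IsCk.prodMk : ∀ {k : ℕ} {E : Type (max u v)} [AddCommGroup E] [Module 𝕜 E]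
    [TopologicalSpace E] {U : Set E} {f : E → F} {g : E → G}, IsCk.{u, v, w} 𝕜 k U f →
    IsCk.{u, v, w'} 𝕜 k U g → IsCk.{u, v, max w w'} 𝕜 k U (fun x => (f x, g x))
  | 0, _, _, _, _, _, _, _, hf, hg => ContinuousOn.prodMk hf hg
  | _ + 1, _, _, _, _, _, _, _, ⟨hc, f1, hf, hfk⟩, ⟨hc', g1, hg, hgk⟩ =>
    ⟨hc.prodMk hc', fun p => (f1 p, g1 p),
      fun x y t hp => by rw [Prod.mk_sub_mk, hf x y t hp, hg x y t hp, Prod.smul_mk],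
      hfk.prodMk hgk⟩

theorem isCk_pi {ι : Type} : ∀ {k : ℕ} {E : Type (max u v)} [AddCommGroup E] [Module 𝕜 E]
    [TopologicalSpace E] {U : Set E} {f : E → ι → F},
    (∀ i, IsCk.{u, v, w} 𝕜 k U (fun x => f x i)) → IsCk.{u, v, w} 𝕜 k U f
  | 0, _, _, _, _, _, _, h => continuousOn_pi.2 h
  | _ + 1, _, _, _, _, _, _, h => by
    choose hc g hg hgk using h
    exact ⟨continuousOn_pi.2 hc, fun p i => g i p,
      fun x y t hp => funext fun i => hg i x y t hp, isCk_pi hgk⟩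

theorem IsCk.comp_clm : ∀ {k : ℕ} {D : Type (max u' v)} [AddCommGroup D] [Module 𝕜 D]
    [TopologicalSpace D] {E : Type (max u v)} [AddCommGroup E] [Module 𝕜 E]
    [TopologicalSpace E] {U : Set D} {V : Set E} {f : E → F} (L : D →L[𝕜] E),
    IsCk.{u, v, w} 𝕜 k V f → MapsTo L U V → IsCk.{u', v, w} 𝕜 k U (fun x => f (L x))
  | 0, _, _, _, _, _, _, _, _, _, _, _, L, hf, h =>
    ContinuousOn.comp hf L.continuous.continuousOn h
  | k + 1, D, _, _, _, E, _, _, _, U, V, f, L, ⟨hc, f1, hf, hfk⟩, h =>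
    ⟨hc.comp L.continuous.continuousOn h,
      fun p => f1 ((L.prodMap (L.prodMap (ContinuousLinearMap.id 𝕜 𝕜))) p),
      fun x y t hp => by simpa using hf (L x) (L y) t ⟨h hp.1, by simpa using h hp.2⟩,
      hfk.comp_clm _ fun p hp => ⟨h hp.1, by simpa using h hp.2⟩⟩

/-- Chain rule: `(f ∘ g)^{[1]} (x, y, t) = f^{[1]} (g x, g^{[1]} (x, y, t), t)`. -/
theorem IsCk.comp : ∀ {k : ℕ} {D : Type (max u' v)} [AddCommGroup D] [Module 𝕜 D]
    [TopologicalSpace D] {E : Type (max u v)} [AddCommGroup E] [Module 𝕜 E]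
    [TopologicalSpace E] {U : Set D} {V : Set E} {f : E → F} {g : D → E},
    IsCk.{u, v, w} 𝕜 k V f → IsCk.{u', v, max u v} 𝕜 k U g → MapsTo g U V →
    IsCk.{u', v, w} 𝕜 k U (f ∘ g)
  | 0, _, _, _, _, _, _, _, _, _, _, _, _, hf, hg, h => ContinuousOn.comp hf hg h
  | k + 1, D, _, _, _, E, _, _, _, U, V, f, g, ⟨hc, f1, hf, hfk⟩, hg', h => by
    have hgk' := hg'.of_succ
    obtain ⟨hc', g1, hg, hgk⟩ := hg'
    have key : ∀ x y : D, ∀ t : 𝕜, (x, y, t) ∈ dqDomain 𝕜 U →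
        g (x + t • y) = g x + t • g1 (x, y, t) := fun x y t hp => by
      rw [← hg x y t hp]; abel
    have h1 : IsCk.{u', v, max u v} 𝕜 k (dqDomain 𝕜 U) (fun p => g p.1) :=
      IsCk.comp_clm.{u', v, max u v, u'} (ContinuousLinearMap.fst 𝕜 D (D × 𝕜)) hgk'
        (fun p hp => hp.1)
    have h2 : IsCk.{u', v, v} 𝕜 k (dqDomain 𝕜 U) (fun p : D × D × 𝕜 => p.2.2) :=
      ContinuousLinearMap.isCk.{u', v, v}
        (ContinuousLinearMap.snd 𝕜 D 𝕜 ∘L ContinuousLinearMap.snd 𝕜 D (D × 𝕜))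
    refine ⟨hc.comp hc' h, f1 ∘ fun p => (g p.1, g1 p, p.2.2), ?_, ?_⟩
    · intro x y t hp
      have := hf (g x) (g1 (x, y, t)) t ⟨h hp.1, by
        show g x + t • g1 (x, y, t) ∈ V
        rw [← key x y t hp]; exact h hp.2⟩
      rw [← key x y t hp] at this
      exact this
    · refine IsCk.comp hfk
        (IsCk.prodMk.{u', v, max u v, max u v} h1 (IsCk.prodMk.{u', v, max u v, v} hgk h2)) ?_
      rintro ⟨x, y, t⟩ hp
      refine ⟨h hp.1, ?_⟩
      show g x + t • g1 (x, y, t) ∈ V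
      rw [← key x y t hp]; exact h hp.2

variable {k : ℕ} {E : Type (max u v)} [AddCommGroup E] [Module 𝕜 E] [TopologicalSpace E]
  {U : Set E}

theorem IsCk.add [ContinuousAdd F] {f g : E → F} (hf : IsCk.{u, v, w} 𝕜 k U f)
    (hg : IsCk.{u, v, w} 𝕜 k U g) : IsCk.{u, v, w} 𝕜 k U (fun x => f x + g x) :=
  (hf.prodMk hg).clm_comp (ContinuousLinearMap.fst 𝕜 F F + ContinuousLinearMap.snd 𝕜 F F)

theorem IsCk.neg [IsTopologicalAddGroup F] {f : E → F} (hf : IsCk.{u, v, w} 𝕜 k U f) :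
    IsCk.{u, v, w} 𝕜 k U (fun x => - f x) :=
  hf.clm_comp (- ContinuousLinearMap.id 𝕜 F)

theorem IsCk.sub [IsTopologicalAddGroup F] {f g : E → F} (hf : IsCk.{u, v, w} 𝕜 k U f)
    (hg : IsCk.{u, v, w} 𝕜 k U g) : IsCk.{u, v, w} 𝕜 k U (fun x => f x - g x) := by
  simpa only [sub_eq_add_neg] using hf.add hg.neg

theorem isCk_id : IsCk.{u, v, max u v} 𝕜 k U (fun x : E => x) :=
  ContinuousLinearMap.isCk.{u, v, max u v} (ContinuousLinearMap.id 𝕜 E)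

theorem isCk_fst {U : Set (E × E × 𝕜)} :
    IsCk.{u, v, max u v} 𝕜 k U (fun p : E × E × 𝕜 => p.1) :=
  ContinuousLinearMap.isCk.{u, v, max u v} (ContinuousLinearMap.fst 𝕜 E (E × 𝕜))

theorem isCk_snd_fst {U : Set (E × E × 𝕜)} :
    IsCk.{u, v, max u v} 𝕜 k U (fun p : E × E × 𝕜 => p.2.1) :=
  ContinuousLinearMap.isCk.{u, v, max u v}
    (ContinuousLinearMap.fst 𝕜 E 𝕜 ∘L ContinuousLinearMap.snd 𝕜 E (E × 𝕜))

theorem isCk_snd_snd {U : Set (E × E × 𝕜)} :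
    IsCk.{u, v, v} 𝕜 k U (fun p : E × E × 𝕜 => p.2.2) :=
  ContinuousLinearMap.isCk.{u, v, v}
    (ContinuousLinearMap.snd 𝕜 E 𝕜 ∘L ContinuousLinearMap.snd 𝕜 E (E × 𝕜))

theorem IsCk.comp_fst {f : E → F} (hf : IsCk.{u, v, w} 𝕜 k U f) :
    IsCk.{u, v, w} 𝕜 k (dqDomain 𝕜 U) (fun p => f p.1) :=
  IsCk.comp.{u, v, w, u} hf isCk_fst (fun _ hp => hp.1)

/-- Product rule for scalar functions:
`(f g)^{[1]} (x, y, t) = f^{[1]} g x + (f x + t f^{[1]}) g^{[1]}`. -/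
theorem IsCk.mul : ∀ {k : ℕ} {E : Type (max u v)} [AddCommGroup E] [Module 𝕜 E]
    [TopologicalSpace E] {U : Set E} {f g : E → 𝕜}, IsCk.{u, v, v} 𝕜 k U f →
    IsCk.{u, v, v} 𝕜 k U g → IsCk.{u, v, v} 𝕜 k U (fun x => f x * g x)
  | 0, _, _, _, _, _, _, _, hf, hg => ContinuousOn.mul hf hg
  | k + 1, _, _, _, _, U, f, g, hf', hg' => by
    have hfk' := hf'.of_succ.comp_fst
    have hgk' := hg'.of_succ.comp_fst
    obtain ⟨hc, f1, hf, hfk⟩ := hf'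
    obtain ⟨hc', g1, hg, hgk⟩ := hg'
    refine ⟨hc.mul hc', fun p => f1 p * g p.1 + (f p.1 + p.2.2 * f1 p) * g1 p, ?_,
      (hfk.mul hgk').add ((hfk'.add (isCk_snd_snd.mul hfk)).mul hgk)⟩
    intro x y t hp
    have h1 := hf x y t hp
    have h2 := hg x y t hp
    simp only [smul_eq_mul] at h1 h2 ⊢
    rw [sub_eq_iff_eq_add] at h1 h2
    rw [h1, h2]
    ring

/-- Product rule for the multiplication of vectors by scalars, see `IsCk.mul`. -/
theorem IsCk.smul [ContinuousAdd F] [ContinuousSMul 𝕜 F] :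
    ∀ {k : ℕ} {E : Type (max u v)} [AddCommGroup E] [Module 𝕜 E]
    [TopologicalSpace E] {U : Set E} {f : E → 𝕜} {g : E → F}, IsCk.{u, v, v} 𝕜 k U f →
    IsCk.{u, v, w} 𝕜 k U g → IsCk.{u, v, w} 𝕜 k U (fun x => f x • g x)
  | 0, _, _, _, _, _, _, _, hf, hg => ContinuousOn.smul hf hg
  | k + 1, _, _, _, _, U, f, g, hf', hg' => by
    have hfk' := hf'.of_succ.comp_fst
    have hgk' := hg'.of_succ.comp_fst
    obtain ⟨hc, f1, hf, hfk⟩ := hf'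
    obtain ⟨hc', g1, hg, hgk⟩ := hg'
    refine ⟨hc.smul hc', fun p => f1 p • g p.1 + (f p.1 + p.2.2 * f1 p) • g1 p, ?_,
      (hfk.smul hgk').add ((hfk'.add (isCk_snd_snd.mul hfk)).smul hgk)⟩
    intro x y t hp
    have h1 := hf x y t hp
    have h2 := hg x y t hp
    rw [sub_eq_iff_eq_add] at h1 h2
    simp only [smul_eq_mul] at h1 ⊢
    rw [h1, h2]
    module

theorem isCk_add_smul [ContinuousAdd E] [ContinuousSMul 𝕜 E] {U : Set (E × E × 𝕜)} :
    IsCk.{u, v, max u v} 𝕜 k U (fun p : E × E × 𝕜 => p.1 + p.2.2 • p.2.1) :=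
  isCk_fst.add (isCk_snd_snd.smul isCk_snd_fst)

theorem isCk_inv : ∀ {k : ℕ}, IsCk.{0, v, v} 𝕜 k {x : 𝕜 | x ≠ 0} (fun x => x⁻¹)
  | 0 => continuousOn_inv₀
  | k + 1 => by
    refine ⟨continuousOn_inv₀, fun p => -(p.2.1 * (p.1⁻¹ * (p.1 + p.2.2 • p.2.1)⁻¹)), ?_, ?_⟩
    · rintro x y t ⟨hx : x ≠ 0, hy : x + t • y ≠ 0⟩
      simp only [smul_eq_mul] at hy ⊢
      field_simp
      ring
    · exact ((isCk_snd_fst.{0, v} (E := 𝕜)).mul ((isCk_inv (k := k)).comp_fst.mul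
        (IsCk.comp.{0, v, v, 0} (isCk_inv (k := k)) (isCk_add_smul.{0, v} (E := 𝕜))
          (fun _ hp => hp.2)))).neg

section Local

variable [IsTopologicalAddGroup E] [ContinuousSMul 𝕜 E] [T2Space F]

theorem isCk_succ_iff (hU : IsOpen U) {f : E → F} :
    IsCk.{u, v, w} 𝕜 (k + 1) U f ↔ ContinuousOn f U ∧ IsCk.{u, v, w} 𝕜 k (dqDomain 𝕜 U) (dq 𝕜 f) :=
  ⟨fun ⟨hc, _, hg, hgk⟩ => ⟨hc, hgk.congr (hg.dq_eq hU hgk.continuousOn)⟩,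
    fun ⟨hc, h⟩ => ⟨hc, _, isDiffQuot_dq U f, h⟩⟩

end Local

theorem continuousOn_of_locally {X Y : Type*} [TopologicalSpace X] [TopologicalSpace Y]
    {U : Set X} {f : X → Y} (h : ∀ x ∈ U, ∃ V, IsOpen V ∧ x ∈ V ∧ ContinuousOn f V) :
    ContinuousOn f U := fun x hx => by
  obtain ⟨V, hV, hxV, hf⟩ := h x hx
  exact (hf.continuousAt (hV.mem_nhds hxV)).continuousWithinAt

/-- Being of class `C^k` is a local property. Near a point `(x, y, t)` of `U^{[1]}` with `t ≠ 0`
this uses the `C^k` property of `f` near `x` and near `x + t y`. -/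
theorem isCk_of_locally [IsTopologicalAddGroup F] [ContinuousSMul 𝕜 F] [T2Space F] :
    ∀ {k : ℕ} {E : Type (max u v)} [AddCommGroup E] [Module 𝕜 E] [TopologicalSpace E]
    [IsTopologicalAddGroup E] [ContinuousSMul 𝕜 E] {U : Set E} {f : E → F},
    (∀ x ∈ U, ∃ V, IsOpen V ∧ x ∈ V ∧ IsCk.{u, v, w} 𝕜 k V f) → IsCk.{u, v, w} 𝕜 k U f
  | 0, _, _, _, _, _, _, _, _, h => continuousOn_of_locally h
  | k + 1, E, _, _, _, _, _, U, f, h => by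
    refine ⟨continuousOn_of_locally fun x hx => ?_, dq 𝕜 f, isDiffQuot_dq U f, ?_⟩
    · obtain ⟨V, hV, hxV, hf⟩ := h x hx
      exact ⟨V, hV, hxV, hf.1⟩
    refine isCk_of_locally ?_
    rintro ⟨x, y, t⟩ ⟨hx : x ∈ U, hy : x + t • y ∈ U⟩
    obtain ⟨V, hV, hxV, hf⟩ := h x hx
    by_cases ht : t = 0
    · subst ht
      exact ⟨dqDomain 𝕜 V, isOpen_dqDomain hV, ⟨hxV, by simpa using hxV⟩,
        ((isCk_succ_iff hV).1 hf).2⟩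
    obtain ⟨V', hV', hyV', hf'⟩ := h _ hy
    have hcont : Continuous fun p : E × E × 𝕜 => p.1 + p.2.2 • p.2.1 := by fun_prop
    refine ⟨{p | p.1 ∈ V ∧ p.1 + p.2.2 • p.2.1 ∈ V' ∧ p.2.2 ≠ 0}, ?_, ⟨hxV, hyV', ht⟩, ?_⟩
    · exact (hV.preimage continuous_fst).inter ((hV'.preimage hcont).inter
        (isOpen_ne.preimage continuous_snd.snd))
    · refine IsCk.congr (f := fun p => (p.2.2)⁻¹ • (f (p.1 + p.2.2 • p.2.1) - f p.1)) ?_ ?_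
      · exact IsCk.smul
          (IsCk.comp.{0, v, v, u} isCk_inv isCk_snd_snd fun p hp => hp.2.2)
          (IsCk.sub
            (IsCk.comp.{u, v, w, u} hf'.of_succ isCk_add_smul fun p hp => hp.2.1)
            (IsCk.comp.{u, v, w, u} hf.of_succ isCk_fst fun p hp => hp.1))
      · rintro ⟨a, b, s⟩ hp
        exact (dq_of_ne f a b hp.2.2).symm

end Ck

end Calculus

/-! ### Smooth curves through rapidly converging sequences -/

section Curves

open Set Filter

/-- A class of scalar functions on normed spaces, stable under forming difference quotients and
bounded on bounded sets, which contains all functions `t ↦ θ (a t + b)` for a fixed bump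
function `θ`. Boundedness on bounded sets is a separate requirement since `𝕜` need not be locally
compact; it is what makes the difference quotients of all orders of `t ↦ θ (a t + b)`
controllable. -/
structure BumpCalculus (𝕜 : Type v) [NontriviallyNormedField 𝕜] where
  /-- The functions in the class. -/
  nice : ∀ {D : Type v} [NormedAddCommGroup D] [NormedSpace 𝕜 D], (D → 𝕜) → Prop
  continuous : ∀ {D : Type v} [NormedAddCommGroup D] [NormedSpace 𝕜 D] {f : D → 𝕜},
    nice f → Continuous f
  bounded : ∀ {D : Type v} [NormedAddCommGroup D] [NormedSpace 𝕜 D] {f : D → 𝕜},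
    nice f → ∀ R : ℝ, ∃ C : ℝ, ∀ x, ‖x‖ ≤ R → ‖f x‖ ≤ C
  diffQuot : ∀ {D : Type v} [NormedAddCommGroup D] [NormedSpace 𝕜 D] {f : D → 𝕜},
    nice f → ∃ g : D × D × 𝕜 → 𝕜, IsDiffQuot univ f g ∧ nice g
  /-- The bump function. -/
  bump : 𝕜 → 𝕜
  nice_bump : ∀ a b : 𝕜, nice (fun t => bump (a * t + b))
  bump_eq_one : ∀ t, ‖t‖ ≤ 1 → bump t = 1
  bump_eq_zero : ∀ t, 2 ≤ ‖t‖ → bump t = 0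
  norm_bump_le : ∀ t, ‖bump t‖ ≤ 1

variable {𝕜 : Type v} [NontriviallyNormedField 𝕜]

/-- The supremum over the closed ball of radius `R` of the norm of the `k`-fold iterated
difference quotient of `f` (a junk value if that is unbounded there). -/
noncomputable def dqBound : ℕ → ∀ {D : Type v} [NormedAddCommGroup D] [NormedSpace 𝕜 D],
    (D → 𝕜) → ℝ → ℝ
  | 0, _, _, _, f, R => sSup ((fun x => ‖f x‖) '' Metric.closedBall 0 R)
  | k + 1, _, _, _, f, R => dqBound k (dq 𝕜 f) R

namespace BumpCalculus

variable (N : BumpCalculus 𝕜)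

section

variable {D : Type v} [NormedAddCommGroup D] [NormedSpace 𝕜 D] {f : D → 𝕜}

theorem nice_dq (hf : N.nice f) : N.nice (dq 𝕜 f) := by
  obtain ⟨g, hg, hgn⟩ := N.diffQuot hf
  have : g = dq 𝕜 f := funext fun p =>
    hg.dq_eq isOpen_univ (N.continuous hgn).continuousOn (by simp)
  exact this ▸ hgn

theorem norm_le_dqBound (hf : N.nice f) {x : D} {R : ℝ} (hx : ‖x‖ ≤ R) :
    ‖f x‖ ≤ dqBound 0 f R := by
  obtain ⟨C, hC⟩ := N.bounded hf R
  refine le_csSup ⟨C, ?_⟩ ⟨x, by simpa using hx, rfl⟩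
  rintro _ ⟨y, hy, rfl⟩
  exact hC y (by simpa using hy)

end

theorem isCk_of_nice : ∀ (k : ℕ) {D : Type v} [NormedAddCommGroup D] [NormedSpace 𝕜 D]
    {f : D → 𝕜}, N.nice f → IsCk.{0, v, v} 𝕜 k univ f
  | 0, _, _, _, _, hf => (N.continuous hf).continuousOn
  | k + 1, _, _, _, f, hf => ⟨(N.continuous hf).continuousOn, dq 𝕜 f, isDiffQuot_dq _ f, by
      rw [dqDomain_univ]; exact isCk_of_nice k (N.nice_dq hf)⟩

end BumpCalculus

section Sum

variable {E : Type w} [AddCommGroup E] [TopologicalSpace E] {s : ℕ → Set E}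

/-- If `s (n + 1) + s (n + 1) ⊆ s n` then tails of sums of elements `a n ∈ s (n + 1)` are small. -/
theorem sum_mem_of_add_subset {E : Type w} [AddCommGroup E] {s : ℕ → Set E}
    (h0 : ∀ n, (0 : E) ∈ s n)
    (hs : ∀ n, ∀ x ∈ s (n + 1), ∀ y ∈ s (n + 1), x + y ∈ s n) {a : ℕ → E} :
    ∀ (j n : ℕ), (∀ m, n ≤ m → a m ∈ s (m + 1)) → ∑ i ∈ Finset.range j, a (n + i) ∈ s n
  | 0, n, _ => by simpa using h0 n
  | j + 1, n, ha => by
    rw [Finset.sum_range_succ', add_comm]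
    refine hs n _ (ha n le_rfl) _ ?_
    have := sum_mem_of_add_subset h0 hs j (n + 1) fun m hm => ha m (by omega)
    simpa only [add_assoc, add_comm 1] using this

theorem finsum_sub_sum_range_mem {E : Type w} [AddCommGroup E] {s : ℕ → Set E}
    (h0 : ∀ n, (0 : E) ∈ s n)
    (hs : ∀ n, ∀ x ∈ s (n + 1), ∀ y ∈ s (n + 1), x + y ∈ s n) {a : ℕ → E}
    (hfin : (Function.support a).Finite) {n : ℕ} (ha : ∀ m, n ≤ m → a m ∈ s (m + 1)) :
    ∑ᶠ m, a m - ∑ m ∈ Finset.range n, a m ∈ s n := by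
  obtain ⟨b, hb⟩ := hfin.bddAbove
  have h : ∑ᶠ m, a m = ∑ m ∈ Finset.range (n + (b + 1)), a m := by
    apply finsum_eq_sum_of_support_subset
    intro m hm
    have := hb hm
    simp only [Finset.coe_range, mem_Iio]
    omega
  rw [h, Finset.sum_range_add, add_sub_cancel_left]
  exact sum_mem_of_add_subset h0 hs _ _ ha

variable [Module 𝕜 E] [IsTopologicalAddGroup E] [ContinuousSMul 𝕜 E] (N : BumpCalculus 𝕜)
  (hbasis : (𝓝 (0 : E)).HasAntitoneBasis s)
  (hs : ∀ n, ∀ x ∈ s (n + 1), ∀ y ∈ s (n + 1), x + y ∈ s n)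
  {v : ℕ → E} {B : ℕ → ℝ} (hv : ∀ n, ∀ a : 𝕜, ‖a‖ ≤ B n → a • v n ∈ s (n + 1))

include hbasis hs hv

theorem continuous_finsum_smul {D : Type v} [NormedAddCommGroup D] [NormedSpace 𝕜 D]
    {h : ℕ → D → 𝕜} (hn : ∀ n, N.nice (h n)) (hfin : ∀ x, {n | h n x ≠ 0}.Finite)
    (hB : ∀ᶠ n : ℕ in atTop, dqBound 0 (h n) n ≤ B n) :
    Continuous fun x => ∑ᶠ n, h n x • v n := by
  have h0 : ∀ n, (0 : E) ∈ s n := fun n => mem_of_mem_nhds (hbasis.1.mem_of_mem trivial)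
  rw [continuous_iff_continuousAt]
  intro x
  unfold ContinuousAt
  rw [← tendsto_sub_nhds_zero_iff, tendsto_def]
  intro O hO
  -- split into a finite partial sum and two small tails
  have hlim : Tendsto (fun p : E × E × E => p.1 + p.2.1 - p.2.2) (𝓝 (0, 0, 0)) (𝓝 0) := by
    have : Continuous fun p : E × E × E => p.1 + p.2.1 - p.2.2 := by fun_prop
    simpa using this.tendsto (0, 0, 0)
  have hO' := hlim hO
  rw [mem_map, nhds_prod_eq, nhds_prod_eq] at hO'
  obtain ⟨O₁, hO₁, O₂₃, hO₂₃, hsub⟩ := mem_prod_iff.1 hO'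
  obtain ⟨O₂, hO₂, O₃, hO₃, hsub'⟩ := mem_prod_iff.1 hO₂₃
  obtain ⟨n₁, hn₁⟩ := hbasis.mem_iff.1 (inter_mem hO₂ hO₃)
  obtain ⟨n₂, hn₂⟩ := eventually_atTop.1 hB
  obtain ⟨n₃, hn₃⟩ := exists_nat_ge (‖x‖ + 1)
  set n := max n₁ (max n₂ n₃) with hndef
  have hle₁ : n₁ ≤ n := le_max_left _ _
  have hle₂ : n₂ ≤ n := (le_max_left _ _).trans (le_max_right _ _)
  have hle₃ : n₃ ≤ n := (le_max_right _ _).trans (le_max_right _ _)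
  have hsupp : ∀ y, (Function.support fun m => h m y • v m).Finite := fun y =>
    (hfin y).subset fun m hm hm' => hm (by simp [hm'])
  have tail : ∀ y, ‖y‖ ≤ ‖x‖ + 1 →
      ∑ᶠ m, h m y • v m - ∑ m ∈ Finset.range n, h m y • v m ∈ s n := fun y hy =>
    finsum_sub_sum_range_mem h0 hs (hsupp y) fun m hm => hv m _ <| by
      refine (N.norm_le_dqBound (hn m) (hy.trans (hn₃.trans ?_))).trans (hn₂ m (hle₂.trans hm))
      exact_mod_cast hle₃.trans hm
  have hpart : Tendsto (fun y => ∑ m ∈ Finset.range n, h m y • v m -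
      ∑ m ∈ Finset.range n, h m x • v m) (𝓝 x) (𝓝 0) := by
    rw [tendsto_sub_nhds_zero_iff]
    exact Continuous.tendsto (continuous_finsetSum _ fun m _ =>
      (N.continuous (hn m)).smul continuous_const) x
  have hball : ∀ᶠ y in 𝓝 x, ‖y‖ < ‖x‖ + 1 :=
    continuous_norm.continuousAt.eventually_lt continuousAt_const (lt_add_one _)
  filter_upwards [hpart hO₁, hball] with y hy₁ hy₂
  have hy := hn₁ (hbasis.antitone hle₁ (tail y hy₂.le))
  have hx := hn₁ (hbasis.antitone hle₁ (tail x (by linarith)))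
  have := hsub (mk_mem_prod hy₁ (hsub' (mk_mem_prod hy.1 hx.2)))
  simp only [mem_preimage] at this ⊢
  convert this using 1
  abel

/-- Sums `∑ h_n(x) v_n` over a family `h` of scalar functions that is finite near each point (up to
neighbourhoods depending on the index) are `C^k` if `v` tends to zero rapidly compared with the
difference quotients of the `h_n`: then `∑ h_n^{[1]} v_n` is the difference quotient, and the
hypotheses pass from the family `h` to the family of the `h_n^{[1]}`. -/
theorem isCk_finsum_smul : ∀ (k : ℕ) {D : Type v} [NormedAddCommGroup D] [NormedSpace 𝕜 D]
    {h : ℕ → D → 𝕜}, (∀ n, N.nice (h n)) → (∀ x, {n | ¬ ∀ᶠ y in 𝓝 x, h n y = 0}.Finite) →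
    (∀ j ≤ k, ∀ᶠ n : ℕ in atTop, dqBound j (h n) n ≤ B n) →
    IsCk.{0, v, w} 𝕜 k univ fun x => ∑ᶠ n, h n x • v n := by
  have key : ∀ {D : Type v} [TopologicalSpace D] {h : ℕ → D → 𝕜},
      (∀ x, {n | ¬ ∀ᶠ y in 𝓝 x, h n y = 0}.Finite) → ∀ x, {n | h n x ≠ 0}.Finite :=
    fun hfin x => (hfin x).subset fun n hn hn' => hn hn'.self_of_nhds
  intro k
  induction k with
  | zero =>
    intro D _ _ h hn hfin hB
    exact (continuous_finsum_smul N hbasis hs hv hn (key hfin) (hB 0 le_rfl)).continuousOn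
  | succ k ih =>
    intro D _ _ h hn hfin hB
    have hfin' : ∀ p, {n | ¬ ∀ᶠ q in 𝓝 p, dq 𝕜 (h n) q = 0}.Finite := by
      rintro ⟨x, y, t⟩
      refine ((hfin x).union (hfin (x + t • y))).subset fun n hn => ?_
      by_contra hn'
      refine hn ?_
      obtain ⟨h1, h2⟩ : (∀ᶠ z in 𝓝 x, h n z = 0) ∧ ∀ᶠ z in 𝓝 (x + t • y), h n z = 0 := by
        exact ⟨not_not.1 fun h' => hn' (Or.inl h'), not_not.1 fun h' => hn' (Or.inr h')⟩
      have c1 : Tendsto (fun q : D × D × 𝕜 => q.1) (𝓝 (x, y, t)) (𝓝 x) :=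
        continuous_fst.tendsto _
      have c2 : Tendsto (fun q : D × D × 𝕜 => q.1 + q.2.2 • q.2.1) (𝓝 (x, y, t))
          (𝓝 (x + t • y)) :=
        Continuous.tendsto (f := fun q : D × D × 𝕜 => q.1 + q.2.2 • q.2.1) (by fun_prop) _
      filter_upwards [c1.eventually h1.eventually_nhds, c2.eventually h2] with q hq1 hq2
      obtain ⟨x', y', t'⟩ := q
      -- compare with the zero function
      have h0 : dq 𝕜 (h n) (x', y', t') = dq 𝕜 (fun _ : D => (0 : 𝕜)) (x', y', t') :=
        dq_congr hq1.self_of_nhds hq2 (eventually_smul_mem hq1 y')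
      rw [h0]
      exact (IsDiffQuot.dq_eq isOpen_univ (g := fun _ => 0) (fun _ _ _ _ => by simp)
        continuousOn_const (by simp)).symm
    have hn' := fun n => N.nice_dq (hn n)
    have supp : ∀ {D : Type v} [TopologicalSpace D] {h : ℕ → D → 𝕜},
      (∀ x, {n | ¬ ∀ᶠ y in 𝓝 x, h n y = 0}.Finite) → ∀ x,
      (Function.support fun n => h n x • v n).Finite :=
      fun hfin x => (key hfin x).subset fun m hm hm' => hm (by simp [hm'])
    refine ⟨(continuous_finsum_smul N hbasis hs hv hn (key hfin) (hB 0 (by omega))).continuousOn,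
      fun p => ∑ᶠ n, dq 𝕜 (h n) p • v n, ?_, ?_⟩
    · intro x y t _
      rw [smul_finsum' _ (supp hfin' _), ← finsum_sub_distrib (supp hfin _) (supp hfin _)]
      refine finsum_congr fun n => ?_
      rw [← sub_smul, isDiffQuot_dq univ (h n) x y t (by simp), smul_assoc]
    · rw [dqDomain_univ]
      exact ih hn' hfin' fun j hj => hB (j + 1) (by omega)

end Sum

theorem exists_nhds_smul_mem {E : Type w} [AddCommGroup E] [TopologicalSpace E] [Module 𝕜 E]
    [ContinuousSMul 𝕜 E] {O : Set E} (hO : O ∈ 𝓝 (0 : E)) (R : ℝ) :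
    ∃ V ∈ 𝓝 (0 : E), ∀ z ∈ V, ∀ a : 𝕜, ‖a‖ ≤ R → a • z ∈ O := by
  obtain ⟨V, ⟨hV, hbal⟩, hVO⟩ := (nhds_basis_balanced 𝕜 E).mem_iff.1 hO
  obtain ⟨c, hc⟩ := NormedField.exists_lt_norm 𝕜 (max R 0)
  have hc0 : 0 < ‖c‖ := (le_max_right _ _).trans_lt hc
  refine ⟨(fun z => c • z) ⁻¹' V,
    (continuous_const_smul c).continuousAt.preimage_mem_nhds (by simpa using hV), ?_⟩
  intro z hz a ha
  have : a • z = (a / c) • (c • z) := by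
    rw [smul_smul, div_mul_cancel₀ _ (norm_pos_iff.1 hc0)]
  rw [this]
  apply hVO
  apply hbal.smul_mem _ hz
  rw [norm_div, div_le_one hc0]
  exact ha.trans ((le_max_left _ _).trans hc.le)

/-- Bumps with supports so close to the points `ρ ^ n` that no two of them meet. -/
theorem BumpCalculus.exists_bumps (N : BumpCalculus 𝕜) : ∃ (τ : ℕ → 𝕜) (h : ℕ → 𝕜 → 𝕜),
    Tendsto τ atTop (𝓝 0) ∧ (∀ n, N.nice (h n)) ∧ (∀ n t, ‖h n t‖ ≤ 1) ∧
    (∀ n, h n (τ n) = 1) ∧ (∀ m n, m ≠ n → h m (τ n) = 0) ∧ (∀ n, h n 0 = 0) ∧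
    ∀ t, {n | ¬ ∀ᶠ t' in 𝓝 t, h n t' = 0}.Finite := by
  obtain ⟨ρ, hρ0, hρ⟩ := NormedField.exists_norm_lt 𝕜 (r := 1 / 4) (by norm_num)
  have hne : ρ ≠ 0 := norm_pos_iff.1 hρ0
  have hτ : Tendsto (fun n => ρ ^ n) atTop (𝓝 0) :=
    tendsto_pow_atTop_nhds_zero_of_norm_lt_one (by linarith)
  have hpos : ∀ n, 0 < ‖ρ ^ n‖ := fun n => norm_pos_iff.2 (pow_ne_zero _ hne)
  have hsupp : ∀ n t, ‖ρ ^ n‖ / 2 ≤ ‖t - ρ ^ n‖ →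
      N.bump ((ρ ^ (n + 1))⁻¹ * t + -ρ⁻¹) = 0 := by
    intro n t ht
    apply N.bump_eq_zero
    have : (ρ ^ (n + 1))⁻¹ * t + -ρ⁻¹ = (ρ ^ n)⁻¹ * ρ⁻¹ * (t - ρ ^ n) := by
      field_simp
      ring
    rw [this, norm_mul, norm_mul, norm_inv, norm_inv]
    have h4 : 4 ≤ ‖ρ‖⁻¹ := by
      rw [le_inv_comm₀ (by norm_num) hρ0]; linarith
    calc (2 : ℝ) = ‖ρ ^ n‖⁻¹ * 4 * (‖ρ ^ n‖ / 2) := by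
          field_simp [(hpos n).ne']; norm_num
      _ ≤ _ := by gcongr
  have hlt : ∀ m n, m < n → ‖ρ ^ n‖ ≤ ‖ρ ^ m‖ / 4 := by
    intro m n hmn
    obtain ⟨j, rfl⟩ := Nat.exists_eq_add_of_lt hmn
    rw [show m + j + 1 = m + (j + 1) by ring, pow_add, pow_succ, norm_mul, norm_mul, norm_pow ρ j]
    have h1 : ‖ρ‖ ^ j ≤ 1 := pow_le_one₀ hρ0.le (by linarith)
    have h2 : ‖ρ‖ ^ j * ‖ρ‖ ≤ 1 / 4 := by nlinarith [pow_nonneg hρ0.le j]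
    have := mul_le_mul_of_nonneg_left h2 (hpos m).le
    linarith
  refine ⟨fun n => ρ ^ n, fun n t => N.bump ((ρ ^ (n + 1))⁻¹ * t + -ρ⁻¹), hτ,
    fun n => N.nice_bump _ _, fun n t => N.norm_bump_le _, ?_, ?_, ?_, ?_⟩
  · intro n
    apply N.bump_eq_one
    have : (ρ ^ (n + 1))⁻¹ * ρ ^ n + -ρ⁻¹ = 0 := by
      field_simp
      ring
    rw [this]; simp
  · intro m n hmn
    apply hsupp
    rcases hmn.lt_or_gt with h | h
    · have h1 := hlt m n h
      have h2 := norm_sub_norm_le (ρ ^ m) (ρ ^ n)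
      rw [norm_sub_rev] at h2
      linarith [hpos m]
    · have h1 := hlt n m h
      have h2 := norm_sub_norm_le (ρ ^ n) (ρ ^ m)
      linarith [hpos m]
  · intro n
    apply hsupp
    rw [zero_sub, norm_neg]
    linarith [hpos n]
  · intro t
    by_cases ht : t = 0
    · convert Set.finite_empty
      rw [eq_empty_iff_forall_notMem]
      intro n hn
      apply hn
      have : ∀ᶠ t' in 𝓝 t, ‖t'‖ < ‖ρ ^ n‖ / 2 :=
        continuous_norm.continuousAt.eventually_lt continuousAt_const
          (by simpa only [ht, norm_zero] using half_pos (hpos n))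
      filter_upwards [this] with t' ht'
      apply hsupp
      have h2 := norm_sub_norm_le (ρ ^ n) t'
      rw [norm_sub_rev] at h2
      linarith
    · have ht' : 0 < ‖t‖ := norm_pos_iff.2 ht
      have hev : ∀ᶠ n in atTop, ‖ρ ^ n‖ < ‖t‖ / 4 := by
        have := hτ.norm
        rw [norm_zero] at this
        exact this.eventually_lt_const (by linarith)
      have hev' : ∀ᶠ n in atTop, ∀ᶠ t' in 𝓝 t,
          N.bump ((ρ ^ (n + 1))⁻¹ * t' + -ρ⁻¹) = 0 := by
        filter_upwards [hev] with n hn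
        have : ∀ᶠ t' in 𝓝 t, ‖t‖ / 2 < ‖t'‖ :=
          continuousAt_const.eventually_lt continuous_norm.continuousAt (by linarith)
        filter_upwards [this] with t' ht'
        apply hsupp
        have h2 := norm_sub_norm_le t' (ρ ^ n)
        linarith
      rw [← Nat.cofinite_eq_atTop] at hev'
      exact hev'

/-- A map on an open subset of a first countable topological vector space is continuous if it is
continuous along smooth curves: there is a smooth curve through a suitable subsequence of any
convergent sequence. -/
theorem BumpCalculus.continuousOn_of_curves (N : BumpCalculus 𝕜) {E : Type w} [AddCommGroup E] [Module 𝕜 E]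
    [TopologicalSpace E] [IsTopologicalAddGroup E] [ContinuousSMul 𝕜 E] [FirstCountableTopology E]
    {Z : Type*} [TopologicalSpace Z] {U : Set E} (hU : IsOpen U) {f : E → Z}
    (H : ∀ c : 𝕜 → E, IsSmoothMap.{0, v, w} 𝕜 univ c → (∀ t, c t ∈ U) → Continuous (f ∘ c)) :
    ContinuousOn f U := by
  intro x hx
  apply ContinuousAt.continuousWithinAt
  by_contra hcon
  obtain ⟨O, hO, hOf⟩ : ∃ O ∈ 𝓝 (f x), f ⁻¹' O ∉ 𝓝 x := by
    simpa [ContinuousAt, tendsto_def] using hcon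
  have hbad : ∀ W ∈ 𝓝 (0 : E), ∃ z ∈ W, f (x + z) ∉ O := by
    intro W hW
    by_contra! hall
    apply hOf
    have : Tendsto (fun y => y - x) (𝓝 x) (𝓝 0) := by
      simpa using (continuous_sub_right x).tendsto x
    filter_upwards [this hW] with y hy
    simpa using hall _ hy
  obtain ⟨τ, h, hτ, hn, hle, h1, h0, hz, hfin⟩ := N.exists_bumps
  obtain ⟨s₀, hs₀, hadd₀⟩ := IsTopologicalAddGroup.exists_antitone_basis_nhds_zero E
  -- drop the first few sets of the basis, so that the whole curve stays in `U`
  have hU0 : {z | x + z ∈ U} ∈ 𝓝 (0 : E) :=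
    (continuous_const_add x).continuousAt.preimage_mem_nhds (by simpa using hU.mem_nhds hx)
  obtain ⟨n₀, hn₀⟩ := hs₀.mem_iff.1 hU0
  set s : ℕ → Set E := fun n => s₀ (n + n₀) with hsdef
  have hs : (𝓝 (0 : E)).HasAntitoneBasis s :=
    hs₀.comp_mono (fun a b hab => by simpa using hab) (tendsto_add_atTop_nat n₀)
  have hadd : ∀ n, ∀ a ∈ s (n + 1), ∀ b ∈ s (n + 1), a + b ∈ s n := fun n a ha b hb =>
    hadd₀ (n + n₀) (Set.add_mem_add (by simpa [hsdef, add_right_comm] using ha)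
      (by simpa [hsdef, add_right_comm] using hb))
  -- the diagonal choice of bounds controls all orders of differentiability at once
  let B : ℕ → ℝ := fun n => 1 + ∑ j ∈ Finset.range (n + 1), |dqBound j (h n) n|
  have hB1 : ∀ n, 1 ≤ B n := fun n =>
    le_add_of_nonneg_right (Finset.sum_nonneg fun _ _ => abs_nonneg _)
  have hB : ∀ j, ∀ᶠ n : ℕ in atTop, dqBound j (h n) n ≤ B n := by
    intro j
    filter_upwards [eventually_ge_atTop j] with n hjn
    have : |dqBound j (h n) n| ≤ ∑ j ∈ Finset.range (n + 1), |dqBound j (h n) n| :=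
      Finset.single_le_sum (f := fun j => |dqBound j (h n) n|) (fun _ _ => abs_nonneg _)
        (Finset.mem_range.2 (by omega))
    exact (le_abs_self _).trans (this.trans (by simp [B]))
  have hex : ∀ n, ∃ z, f (x + z) ∉ O ∧ ∀ a : 𝕜, ‖a‖ ≤ B n → a • z ∈ s (n + 1) := fun n => by
    obtain ⟨V, hV, hVs⟩ := exists_nhds_smul_mem (𝕜 := 𝕜) (hs.1.mem_of_mem (i := n + 1) trivial)
      (B n)
    obtain ⟨z, hzV, hzO⟩ := hbad V hV
    exact ⟨z, hzO, hVs z hzV⟩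
  choose v hvO hv using hex
  -- the curve `t ↦ x + ∑ h n t • v n` passes through `x + v n` at `τ n` and through `x` at `0`
  have hsmooth : IsSmoothMap.{0, v, w} 𝕜 univ fun t => x + ∑ᶠ n, h n t • v n := fun k =>
    (isCk_const x).add (isCk_finsum_smul N hs hadd hv k hn hfin fun j _ => hB j)
  have hrange : ∀ t, x + ∑ᶠ n, h n t • v n ∈ U := by
    intro t
    have := finsum_sub_sum_range_mem (s := s) (a := fun n => h n t • v n) (n := 0)
      (fun n => mem_of_mem_nhds (hs.1.mem_of_mem trivial)) hadd
      ((hfin t).subset fun n hn hn' => hn (by simp [hn'.self_of_nhds]))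
      (fun m _ => hv m _ ((hle m t).trans (hB1 m)))
    apply hn₀
    simpa [hsdef] using this
  have hcont := (H _ hsmooth hrange).tendsto 0
  have hval : ∀ n, x + ∑ᶠ m, h m (τ n) • v m = x + v n := fun n => by
    rw [finsum_eq_single _ n fun m hm => by rw [h0 m n hm, zero_smul], h1, one_smul]
  have hval0 : x + ∑ᶠ m, h m 0 • v m = x := by simp [hz]
  have := (hcont.comp hτ) (by simpa [hval0] using hO)
  obtain ⟨n, hn⟩ := Filter.Eventually.exists (mem_map.1 this)
  apply hvO n
  simpa [hval] using hn

end Curves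

/-! ### Detecting `C^k` maps along smooth maps from `𝕜^{k+1}` -/

section Detection

open Set Filter

variable {𝕜 : Type v} [NontriviallyNormedField 𝕜]

/-- Smooth maps into an arbitrarily small ball that are the identity near zero. -/
theorem BumpCalculus.exists_cutoff (N : BumpCalculus 𝕜) {ε : ℝ} (hε : 0 < ε) :
    ∃ φ : 𝕜 → 𝕜, (∀ k, IsCk.{0, v, v} 𝕜 k univ φ) ∧ (∀ r, ‖φ r‖ < ε) ∧
      ∃ δ > 0, ∀ r, ‖r‖ < δ → φ r = r := by
  obtain ⟨l, hl⟩ := NormedField.exists_lt_norm 𝕜 (2 / ε)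
  have hl0 : 0 < ‖l‖ := lt_trans (by positivity) hl
  refine ⟨fun r => r * N.bump (l * r + 0),
    fun k => IsCk.mul isCk_id.{0, v} (N.isCk_of_nice k (N.nice_bump l 0)), ?_,
    ‖l‖⁻¹, by positivity, ?_⟩
  · intro r
    rw [norm_mul]
    by_cases h : 2 ≤ ‖l * r + 0‖
    · rw [N.bump_eq_zero _ h]; simpa using hε
    · rw [add_zero, norm_mul, not_le] at h
      rw [div_lt_iff₀ hε] at hl
      have : ‖r‖ < ε := by
        by_contra! hr
        nlinarith
      exact (mul_le_of_le_one_right (norm_nonneg _) (N.norm_bump_le _)).trans_lt this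
  · intro r hr
    show r * N.bump (l * r + 0) = r
    rw [N.bump_eq_one, mul_one]
    rw [add_zero, norm_mul]
    calc ‖l‖ * ‖r‖ ≤ ‖l‖ * ‖l‖⁻¹ := by gcongr
      _ = 1 := mul_inv_cancel₀ hl0.ne'

section

variable {F : Type w} [AddCommGroup F] [Module 𝕜 F] [TopologicalSpace F]

/-- Test maps on a parameter space `P₀` also cover the retracts `P` of `P₀`. -/
theorem isCk_comp_of_retract {P₀ P : Type v} [AddCommGroup P₀] [Module 𝕜 P₀] [TopologicalSpace P₀]
    [AddCommGroup P] [Module 𝕜 P] [TopologicalSpace P] (A : P →L[𝕜] P₀) (A' : P₀ →L[𝕜] P)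
    (hA : ∀ p, A' (A p) = p) {E : Type (max u v)} [AddCommGroup E] [Module 𝕜 E]
    [TopologicalSpace E] {U : Set E} {f : E → F} {k : ℕ}
    (H : ∀ c : P₀ → E, IsSmoothMap.{0, v, max u v} 𝕜 univ c → (∀ s, c s ∈ U) →
      IsCk.{0, v, w} 𝕜 k univ (f ∘ c))
    (c : P → E) (hc : IsSmoothMap.{0, v, max u v} 𝕜 univ c) (hcU : ∀ s, c s ∈ U) :
    IsCk.{0, v, w} 𝕜 k univ (f ∘ c) := by
  have h1 := H (fun s => c (A' s))
    (fun m => IsCk.comp_clm.{0, v, max u v, 0} A' (hc m) (mapsTo_univ _ _)) fun s => hcU _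
  have h2 := IsCk.comp_clm.{0, v, w, 0} A h1 (mapsTo_univ A univ)
  simpa [Function.comp_def, hA] using h2

variable [IsTopologicalAddGroup F] [ContinuousSMul 𝕜 F] [T2Space F]

/-- A map is `C^k` if its composites with all smooth maps from `𝕜^{k+1}` are. In the induction
step the additional parameter produces the difference quotient of `f`: up to a cut-off, the
composite of `f^{[1]}` with a smooth map `(c₁, c₂, c₃)` is, where `c₃` is small, the difference
quotient of `(t, s) ↦ f (c₁ s + t c₂ s)` at `((0, s), (1, 0), c₃ s)`. -/
theorem BumpCalculus.isCk_of_comp (N : BumpCalculus 𝕜) : ∀ (k : ℕ) {E : Type (max u v)}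
    [AddCommGroup E] [Module 𝕜 E] [TopologicalSpace E] [IsTopologicalAddGroup E]
    [ContinuousSMul 𝕜 E] [FirstCountableTopology E] {U : Set E}, IsOpen U → ∀ {f : E → F},
    (∀ c : (Fin (k + 1) → 𝕜) → E, IsSmoothMap.{0, v, max u v} 𝕜 univ c → (∀ s, c s ∈ U) →
      IsCk.{0, v, w} 𝕜 k univ (f ∘ c)) → IsCk.{u, v, w} 𝕜 k U f := by
  have hcont : ∀ (k : ℕ) {E : Type (max u v)}
      [AddCommGroup E] [Module 𝕜 E] [TopologicalSpace E] [IsTopologicalAddGroup E]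
      [ContinuousSMul 𝕜 E] [FirstCountableTopology E] {U : Set E}, IsOpen U → ∀ {f : E → F},
      (∀ c : (Fin (k + 1) → 𝕜) → E, IsSmoothMap.{0, v, max u v} 𝕜 univ c → (∀ s, c s ∈ U) →
        IsCk.{0, v, w} 𝕜 k univ (f ∘ c)) → ContinuousOn f U := by
    intro k E _ _ _ _ _ _ U hU f H
    refine N.continuousOn_of_curves hU fun c hc hcU => ?_
    have := isCk_comp_of_retract.{u, v, w} (ContinuousLinearMap.pi fun _ => .id 𝕜 𝕜)
      (ContinuousLinearMap.proj 0) (fun _ => rfl) H c hc hcU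
    exact continuousOn_univ.1 this.continuousOn
  intro k
  induction k with
  | zero => exact fun hU _ H => hcont 0 hU H
  | succ k ih =>
    intro E _ _ _ _ _ _ U hU f H
    have H1 := isCk_comp_of_retract.{u, v, w} (P := 𝕜 × (Fin (k + 1) → 𝕜))
      (Fin.consEquivL 𝕜 (fun _ : Fin (k + 2) => 𝕜) : 𝕜 × (Fin (k + 1) → 𝕜) →L[𝕜] _)
      ((Fin.consEquivL 𝕜 (fun _ : Fin (k + 2) => 𝕜)).symm : _ →L[𝕜] 𝕜 × (Fin (k + 1) → 𝕜))
      (fun p => (Fin.consEquivL 𝕜 (fun _ : Fin (k + 2) => 𝕜)).symm_apply_apply p) H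
    have H2 := isCk_comp_of_retract.{u, v, w} (ContinuousLinearMap.inr 𝕜 𝕜 (Fin (k + 1) → 𝕜))
      (ContinuousLinearMap.snd 𝕜 𝕜 (Fin (k + 1) → 𝕜)) (fun _ => rfl) H1
    refine ⟨hcont (k + 1) hU H, dq 𝕜 f, isDiffQuot_dq U f, ih (isOpen_dqDomain hU) ?_⟩
    intro c hc hcU
    set c₁ : (Fin (k + 1) → 𝕜) → E := fun s => (c s).1
    set c₂ : (Fin (k + 1) → 𝕜) → E := fun s => (c s).2.1
    set c₃ : (Fin (k + 1) → 𝕜) → 𝕜 := fun s => (c s).2.2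
    have hc₁ : ∀ m, IsCk.{0, v, max u v} 𝕜 m univ c₁ := fun m =>
      (hc m).clm_comp (ContinuousLinearMap.fst 𝕜 E (E × 𝕜))
    have hc₂ : ∀ m, IsCk.{0, v, max u v} 𝕜 m univ c₂ := fun m =>
      (hc m).clm_comp (ContinuousLinearMap.fst 𝕜 E 𝕜 ∘L ContinuousLinearMap.snd 𝕜 E (E × 𝕜))
    have hc₃ : ∀ m, IsCk.{0, v, v} 𝕜 m univ c₃ := fun m =>
      (hc m).clm_comp (ContinuousLinearMap.snd 𝕜 E 𝕜 ∘L ContinuousLinearMap.snd 𝕜 E (E × 𝕜))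
    have cc₁ : Continuous c₁ := continuousOn_univ.1 (hc₁ 0)
    have cc₂ : Continuous c₂ := continuousOn_univ.1 (hc₂ 0)
    have cc₃ : Continuous c₃ := continuousOn_univ.1 (hc₃ 0)
    refine isCk_of_locally.{0, v, w} fun s₀ _ => ?_
    by_cases h0 : c₃ s₀ = 0
    · have hcc : Continuous fun p : 𝕜 × (Fin (k + 1) → 𝕜) => c₁ p.2 + p.1 • c₂ p.2 := by
        fun_prop
      have hnhds : (fun p : 𝕜 × (Fin (k + 1) → 𝕜) => c₁ p.2 + p.1 • c₂ p.2) ⁻¹' U ∈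
          𝓝 ((0 : 𝕜), s₀) := by
        apply hcc.continuousAt.preimage_mem_nhds
        simpa using hU.mem_nhds (hcU s₀).1
      obtain ⟨ε, hε, hball⟩ := Metric.mem_nhds_iff.1 hnhds
      obtain ⟨φ, hφ, hφε, δ, hδ, hφδ⟩ := N.exists_cutoff hε
      let Ψ : 𝕜 × (Fin (k + 1) → 𝕜) → Fin (k + 1) → 𝕜 := fun p i => s₀ i + φ (p.2 i - s₀ i)
      have hfst : ∀ m, IsCk.{0, v, v} 𝕜 m univ (fun p : 𝕜 × (Fin (k + 1) → 𝕜) => φ p.1) := fun m =>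
        IsCk.comp_clm.{0, v, v, 0} (ContinuousLinearMap.fst 𝕜 𝕜 (Fin (k + 1) → 𝕜)) (hφ m)
          (mapsTo_univ _ _)
      have hΨ : ∀ m, IsCk.{0, v, v} 𝕜 m univ Ψ := fun m => isCk_pi fun i =>
        (isCk_const _).add (IsCk.comp.{0, v, v, 0} (hφ m)
          (IsCk.sub (ContinuousLinearMap.isCk.{0, v, v} (ContinuousLinearMap.proj (R := 𝕜) i ∘L
            ContinuousLinearMap.snd 𝕜 𝕜 (Fin (k + 1) → 𝕜))) (isCk_const _)) (mapsTo_univ _ _))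
      let h : 𝕜 × (Fin (k + 1) → 𝕜) → E := fun p => c₁ (Ψ p) + φ p.1 • c₂ (Ψ p)
      have hh : IsSmoothMap.{0, v, max u v} 𝕜 univ h := fun m =>
        (IsCk.comp.{0, v, max u v, 0} (hc₁ m) (hΨ m) (mapsTo_univ _ _)).add
          ((hfst m).smul (IsCk.comp.{0, v, max u v, 0} (hc₂ m) (hΨ m) (mapsTo_univ _ _)))
      have hhU : ∀ p, h p ∈ U := by
        intro p
        apply @hball (φ p.1, Ψ p)
        rw [Metric.mem_ball, Prod.dist_eq, max_lt_iff, dist_pi_lt_iff hε]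
        exact ⟨by simpa using hφε p.1, fun i => by simpa [Ψ] using hφε _⟩
      have hG := ((isCk_succ_iff isOpen_univ).1 (H1 h hh hhU)).2
      have hin : IsCk.{0, v, v} 𝕜 k univ
          ((fun s => ((0, s), (1, 0), c₃ s)) :
            (Fin (k + 1) → 𝕜) → (𝕜 × (Fin (k + 1) → 𝕜)) × (𝕜 × (Fin (k + 1) → 𝕜)) × 𝕜) :=
        IsCk.prodMk ((isCk_const _).prodMk isCk_id.{0, v}) ((isCk_const _).prodMk (hc₃ k))
      have hGc := IsCk.comp.{0, v, w, 0} hG hin (by simp)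
      refine ⟨Metric.ball s₀ δ ∩ {s | ‖c₃ s‖ < δ}, Metric.isOpen_ball.inter
        (isOpen_lt cc₃.norm continuous_const), ⟨Metric.mem_ball_self hδ, by simpa [h0]⟩, ?_⟩
      refine (hGc.mono (subset_univ _)).congr ?_
      rintro s ⟨hs, hs'⟩
      have hΨs : ∀ t, Ψ (t, s) = s := fun t => funext fun i => by
        have : ‖s i - s₀ i‖ < δ := by
          rw [← dist_eq_norm]
          exact (dist_le_pi_dist _ _ i).trans_lt hs
        simp [Ψ, hφδ _ this]
      have hht : ∀ t : 𝕜, ‖t‖ < δ → h ((0, s) + t • (1, 0)) = c₁ s + t • c₂ s := fun t ht => by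
        simp [h, hΨs, hφδ t ht]
      refine dq_congr ?_ ?_ ?_
      · simpa [c₁] using congrArg f (hht 0 (by simpa))
      · exact congrArg f (hht _ hs')
      · have : ∀ᶠ t : 𝕜 in 𝓝 0, ‖t‖ < δ :=
          continuous_norm.continuousAt.eventually_lt continuousAt_const (by simpa)
        filter_upwards [this] with t ht
        exact congrArg f (hht t ht)
    · refine ⟨{s | c₃ s ≠ 0}, isOpen_ne.preimage cc₃, h0, ?_⟩
      have h1 : IsCk.{0, v, w} 𝕜 k univ (f ∘ fun s => c₁ s + c₃ s • c₂ s) :=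
        (H2 _ (fun m => (hc₁ m).add ((hc₃ m).smul (hc₂ m))) fun s => (hcU s).2).of_succ
      have h2 : IsCk.{0, v, w} 𝕜 k univ (f ∘ c₁) :=
        (H2 _ hc₁ fun s => (hcU s).1).of_succ
      refine IsCk.congr (f := fun s => (c₃ s)⁻¹ • (f (c₁ s + c₃ s • c₂ s) - f (c₁ s))) ?_ ?_
      · exact IsCk.smul (IsCk.comp.{0, v, v, 0} isCk_inv ((hc₃ k).mono (subset_univ _))
          fun _ hs => hs) ((h1.sub h2).mono (subset_univ _))
      · intro s hs
        exact (dq_of_ne f (c₁ s) (c₂ s) hs).symm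

theorem BumpCalculus.isCk_iff_and_isSmoothMap_iff (N : BumpCalculus 𝕜) {E : Type (max u v)}
    [AddCommGroup E] [Module 𝕜 E] [TopologicalSpace E] [IsTopologicalAddGroup E]
    [ContinuousSMul 𝕜 E] [FirstCountableTopology E] {U : Set E} (hU : IsOpen U) (f : E → F) :
    (∀ k : ℕ, IsCk.{u, v, w} 𝕜 k U f ↔
        ∀ c : (Fin (k + 1) → 𝕜) → E, IsSmoothMap.{0, v, max u v} 𝕜 Set.univ c →
          (∀ s, c s ∈ U) → IsCk.{0, v, w} 𝕜 k Set.univ (f ∘ c)) ∧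
      (IsSmoothMap.{u, v, w} 𝕜 U f ↔
        ∀ k : ℕ, 1 ≤ k → ∀ c : (Fin k → 𝕜) → E, IsSmoothMap.{0, v, max u v} 𝕜 Set.univ c →
          (∀ s, c s ∈ U) → IsSmoothMap.{0, v, w} 𝕜 Set.univ (f ∘ c)) :=
  ⟨fun k => ⟨fun hf c hc hcU => IsCk.comp.{u, v, w, 0} hf (hc k) fun s _ => hcU s,
      N.isCk_of_comp k hU⟩,
    ⟨fun hf k _ c hc hcU m => IsCk.comp.{u, v, w, 0} (hf m) (hc m) fun s _ => hcU s,
      fun H k => N.isCk_of_comp k hU fun c hc hcU => H (k + 1) (by omega) c hc hcU k⟩⟩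

end

end Detection

/-! ### Bump functions over the real numbers -/

section Real

open Set Filter MeasureTheory
open scoped ContDiff

theorem ContDiff.hasFDerivAt_intervalIntegral {D G : Type*} [NormedAddCommGroup D]
    [NormedSpace ℝ D] [ProperSpace D] [NormedAddCommGroup G] [NormedSpace ℝ G]
    {f : D × ℝ → G} (hf : ContDiff ℝ 1 f) (x : D) :
    HasFDerivAt (fun x => ∫ t in (0 : ℝ)..1, f (x, t))
      (∫ t in (0 : ℝ)..1, (fderiv ℝ f (x, t)).comp (ContinuousLinearMap.inl ℝ D ℝ)) x := by
  have hc : Continuous fun p : D × ℝ => (fderiv ℝ f p).comp (ContinuousLinearMap.inl ℝ D ℝ) :=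
    (hf.continuous_fderiv one_ne_zero).clm_comp continuous_const
  obtain ⟨C, hC⟩ := ((isCompact_closedBall x 1).prod (isCompact_Icc (a := (0 : ℝ)) (b := 1))
    ).exists_bound_of_continuousOn hc.continuousOn
  refine intervalIntegral.hasFDerivAt_integral_of_dominated_of_fderiv_le
    (F' := fun x t => (fderiv ℝ f (x, t)).comp (ContinuousLinearMap.inl ℝ D ℝ))
    (bound := fun _ => C) (Metric.closedBall_mem_nhds x one_pos) ?_ ?_ ?_ ?_ ?_ ?_
  · exact Eventually.of_forall fun y =>
      Continuous.aestronglyMeasurable (hf.continuous.comp (by fun_prop))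
  · exact Continuous.intervalIntegrable (hf.continuous.comp (by fun_prop)) _ _
  · exact Continuous.aestronglyMeasurable (hc.comp (by fun_prop : Continuous fun t => (x, t)))
  · refine Eventually.of_forall fun t ht y hy => hC (y, t) ⟨hy, ?_⟩
    rw [uIoc_of_le zero_le_one] at ht
    exact ⟨ht.1.le, ht.2⟩
  · exact intervalIntegrable_const
  · refine Eventually.of_forall fun t _ y _ => ?_
    have h1 := (hf.differentiable one_ne_zero (y, t)).hasFDerivAt
    exact h1.comp y (hasFDerivAt_prodMk_left y t)

theorem ContDiff.intervalIntegral_param {D : Type} [NormedAddCommGroup D]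
    [NormedSpace ℝ D] [ProperSpace D] : ∀ (n : ℕ) {G : Type} [NormedAddCommGroup G]
    [NormedSpace ℝ G] {f : D × ℝ → G}, ContDiff ℝ n f →
    ContDiff ℝ n fun x => ∫ t in (0 : ℝ)..1, f (x, t)
  | 0, _, _, _, f, hf => by
    rw [Nat.cast_zero, contDiff_zero] at hf ⊢
    exact intervalIntegral.continuous_parametric_intervalIntegral_of_continuous'
      (f := fun x t => f (x, t)) hf 0 1
  | n + 1, _, _, _, f, hf => by
    rw [Nat.cast_succ]
    refine contDiff_succ_iff_hasFDerivAt.2 ⟨_, ?_, fun x =>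
      (hf.of_le (by simp)).hasFDerivAt_intervalIntegral x⟩
    apply ContDiff.intervalIntegral_param n
      (f := fun p => (fderiv ℝ f p).comp (ContinuousLinearMap.inl ℝ D ℝ))
    exact (hf.fderiv_right (by simp)).clm_comp contDiff_const

/-- Over `ℝ`, the class of functions that are smooth in the usual sense, on proper normed spaces:
`f^{[1]} (x, y, t) = ∫₀¹ Df (x + s t y) y ds`. -/
noncomputable def realBumpCalculus : BumpCalculus ℝ where
  nice {D} _ _ f := ProperSpace D ∧ ContDiff ℝ ∞ f
  continuous hf := hf.2.continuous
  bounded {D} _ _ f hf R := by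
    obtain ⟨_, hf⟩ := hf
    obtain ⟨C, hC⟩ := (isCompact_closedBall (0 : D) R).exists_bound_of_continuousOn
      hf.continuous.continuousOn
    exact ⟨C, fun x hx => hC x (by simpa using hx)⟩
  diffQuot {D} _ _ f hf := by
    obtain ⟨_, hf⟩ := hf
    have hf' : ContDiff ℝ ∞ (fderiv ℝ f) := hf.fderiv_right (by simp)
    refine ⟨fun p => ∫ s in (0 : ℝ)..1, fderiv ℝ f (p.1 + s • p.2.2 • p.2.1) p.2.1,
      ?_, inferInstance, ?_⟩
    · intro x y t _
      have h1 : ∀ s : ℝ, HasDerivAt (fun s : ℝ => f (x + s • t • y))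
          (fderiv ℝ f (x + s • t • y) (t • y)) s := fun s => by
        have h2 : HasDerivAt (fun s : ℝ => x + s • t • y) (t • y) s := by
          simpa using ((hasDerivAt_id s).smul_const (t • y)).const_add x
        exact ((hf.differentiable (by simp) _).hasFDerivAt).comp_hasDerivAt s h2
      have hc : Continuous fun s : ℝ => fderiv ℝ f (x + s • t • y) (t • y) :=
        (hf'.continuous.comp (by fun_prop)).clm_apply continuous_const
      have := intervalIntegral.integral_eq_sub_of_hasDerivAt (a := 0) (b := 1) (fun s _ => h1 s)
        (hc.intervalIntegrable _ _)
      simp only [one_smul, zero_smul, add_zero, map_smul] at this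
      rw [← this, intervalIntegral.integral_smul]
    · rw [contDiff_infty]
      intro n
      apply ContDiff.intervalIntegral_param n
        (f := fun q : (D × D × ℝ) × ℝ => fderiv ℝ f (q.1.1 + q.2 • q.1.2.2 • q.1.2.1) q.1.2.1)
      exact ((hf'.of_le (by exact_mod_cast le_top)).comp (by fun_prop)).clm_apply (by fun_prop)
  bump := (⟨1, 2, one_pos, one_lt_two⟩ : ContDiffBump (0 : ℝ))
  nice_bump a b := ⟨inferInstance, (ContDiffBump.contDiff _).comp (by fun_prop)⟩
  bump_eq_one t ht := ContDiffBump.one_of_mem_closedBall _ (by simpa using ht)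
  bump_eq_zero t ht := ContDiffBump.zero_of_le_dist _ (by simpa using ht)
  norm_bump_le t := by
    rw [Real.norm_of_nonneg (ContDiffBump.nonneg _)]
    exact ContDiffBump.le_one _

end Real

/-! ### Bump functions over ultrametric fields -/

section Ultrametric

open Set Filter

variable {𝕜 : Type v} [NontriviallyNormedField 𝕜]

/-- The indicator function of the closed unit ball. -/
noncomputable def unitBallIndicator (s : 𝕜) : 𝕜 :=
  open Classical in if ‖s‖ ≤ 1 then 1 else 0

/-- The inversion map, cut off to zero on the closed unit ball. -/
noncomputable def cutoffInv (s : 𝕜) : 𝕜 :=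
  open Classical in if ‖s‖ ≤ 1 then 0 else s⁻¹

theorem unitBallIndicator_of_le {s : 𝕜} (h : ‖s‖ ≤ 1) : unitBallIndicator s = 1 := if_pos h

theorem unitBallIndicator_of_lt {s : 𝕜} (h : 1 < ‖s‖) : unitBallIndicator s = 0 :=
  if_neg h.not_ge

theorem cutoffInv_of_le {s : 𝕜} (h : ‖s‖ ≤ 1) : cutoffInv s = 0 := if_pos h

theorem cutoffInv_of_lt {s : 𝕜} (h : 1 < ‖s‖) : cutoffInv s = s⁻¹ := if_neg h.not_ge

theorem norm_unitBallIndicator_le (s : 𝕜) : ‖unitBallIndicator s‖ ≤ 1 := by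
  rcases le_or_gt ‖s‖ 1 with h | h
  · simp [unitBallIndicator_of_le h]
  · simp [unitBallIndicator_of_lt h]

theorem norm_cutoffInv_le (s : 𝕜) : ‖cutoffInv s‖ ≤ 1 := by
  rcases le_or_gt ‖s‖ 1 with h | h
  · simp [cutoffInv_of_le h]
  · simpa [cutoffInv_of_lt h] using inv_le_one_of_one_le₀ h.le

/-- The algebra of functions generated by constants, continuous linear functionals, and the
functions obtained from its members by composition with the indicator function of the unit ball or
with the cut-off inversion. It is stable under difference quotients, since those of the two
generating functions are polynomials in these functions themselves. -/
inductive UltraNice : ∀ {D : Type v} [NormedAddCommGroup D] [NormedSpace 𝕜 D], (D → 𝕜) → Prop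
  | const {D : Type v} [NormedAddCommGroup D] [NormedSpace 𝕜 D] (c : 𝕜) :
      UltraNice (fun _ : D => c)
  | linear {D : Type v} [NormedAddCommGroup D] [NormedSpace 𝕜 D] (L : D →L[𝕜] 𝕜) :
      UltraNice (fun x => L x)
  | add {D : Type v} [NormedAddCommGroup D] [NormedSpace 𝕜 D] {f g : D → 𝕜} :
      UltraNice f → UltraNice g → UltraNice (fun x => f x + g x)
  | mul {D : Type v} [NormedAddCommGroup D] [NormedSpace 𝕜 D] {f g : D → 𝕜} :
      UltraNice f → UltraNice g → UltraNice (fun x => f x * g x)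
  | indicator {D : Type v} [NormedAddCommGroup D] [NormedSpace 𝕜 D] {f : D → 𝕜} :
      UltraNice f → UltraNice (fun x => unitBallIndicator (f x))
  | inv {D : Type v} [NormedAddCommGroup D] [NormedSpace 𝕜 D] {f : D → 𝕜} :
      UltraNice f → UltraNice (fun x => cutoffInv (f x))

namespace UltraNice

theorem comp_clm {D : Type v} [NormedAddCommGroup D] [NormedSpace 𝕜 D] {f : D → 𝕜}
    (hf : UltraNice f) {D' : Type v} [NormedAddCommGroup D'] [NormedSpace 𝕜 D']
    (A : D' →L[𝕜] D) : UltraNice (fun x => f (A x)) := by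
  induction hf with
  | const c => exact .const c
  | linear L => exact .linear (L ∘L A)
  | add _ _ h1 h2 => exact .add h1 h2
  | mul _ _ h1 h2 => exact .mul h1 h2
  | indicator _ h => exact .indicator h
  | inv _ h => exact .inv h

theorem sub {D : Type v} [NormedAddCommGroup D] [NormedSpace 𝕜 D] {f g : D → 𝕜}
    (hf : UltraNice f) (hg : UltraNice g) : UltraNice (fun x => f x - g x) := by
  simpa [sub_eq_add_neg] using hf.add ((UltraNice.const (-1)).mul hg)

theorem bounded {D : Type v} [NormedAddCommGroup D] [NormedSpace 𝕜 D] {f : D → 𝕜}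
    (hf : UltraNice f) (R : ℝ) : ∃ C : ℝ, ∀ x, ‖x‖ ≤ R → ‖f x‖ ≤ C := by
  induction hf with
  | const c => exact ⟨‖c‖, fun _ _ => le_rfl⟩
  | linear L =>
    exact ⟨‖L‖ * R, fun x hx => (L.le_opNorm x).trans (by gcongr)⟩
  | add _ _ h1 h2 =>
    obtain ⟨C, hC⟩ := h1
    obtain ⟨C', hC'⟩ := h2
    exact ⟨C + C', fun x hx => (norm_add_le _ _).trans (add_le_add (hC x hx) (hC' x hx))⟩
  | mul _ _ h1 h2 =>
    obtain ⟨C, hC⟩ := h1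
    obtain ⟨C', hC'⟩ := h2
    refine ⟨C * C', fun x hx => ?_⟩
    rw [norm_mul]
    exact mul_le_mul (hC x hx) (hC' x hx) (norm_nonneg _) ((norm_nonneg _).trans (hC x hx))
  | indicator _ _ => exact ⟨1, fun x _ => norm_unitBallIndicator_le _⟩
  | inv _ _ => exact ⟨1, fun x _ => norm_cutoffInv_le _⟩

end UltraNice

variable [IsUltrametricDist 𝕜]

theorem isClopen_norm_le_one : IsClopen {s : 𝕜 | ‖s‖ ≤ 1} := by
  have := IsUltrametricDist.isClopen_closedBall (0 : 𝕜) one_ne_zero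
  simpa [Metric.closedBall, dist_zero_right] using this

theorem continuous_unitBallIndicator : Continuous (unitBallIndicator : 𝕜 → 𝕜) := by
  refine continuous_iff_continuousAt.2 fun s => ?_
  rcases le_or_gt ‖s‖ 1 with h | h
  · refine (continuousAt_const (y := (1 : 𝕜))).congr ?_
    filter_upwards [isClopen_norm_le_one.isOpen.mem_nhds h] with r hr
    exact (unitBallIndicator_of_le hr).symm
  · refine (continuousAt_const (y := (0 : 𝕜))).congr ?_
    filter_upwards [isClopen_norm_le_one.compl.isOpen.mem_nhds h.not_ge] with r hr
    exact (unitBallIndicator_of_lt (not_le.1 hr)).symm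

theorem continuous_cutoffInv : Continuous (cutoffInv : 𝕜 → 𝕜) := by
  refine continuous_iff_continuousAt.2 fun s => ?_
  rcases le_or_gt ‖s‖ 1 with h | h
  · refine (continuousAt_const (y := (0 : 𝕜))).congr ?_
    filter_upwards [isClopen_norm_le_one.isOpen.mem_nhds h] with r hr
    exact (cutoffInv_of_le hr).symm
  · refine (continuousAt_inv₀ (norm_pos_iff.1 (zero_lt_one.trans h))).congr ?_
    filter_upwards [isClopen_norm_le_one.compl.isOpen.mem_nhds h.not_ge] with r hr
    exact (cutoffInv_of_lt (not_le.1 hr)).symm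

/-- The indicator function only changes its value along a step of norm greater than one, for which
the cut-off inversion is the true one. -/
theorem unitBallIndicator_add_sub (s r : 𝕜) :
    unitBallIndicator (s + r) - unitBallIndicator s =
      r * ((unitBallIndicator (s + r) - unitBallIndicator s) * cutoffInv r) := by
  rcases le_or_gt ‖r‖ 1 with hr | hr
  · have : unitBallIndicator (s + r) = unitBallIndicator s := by
      rcases le_or_gt ‖s‖ 1 with hs | hs
      · rw [unitBallIndicator_of_le hs, unitBallIndicator_of_le
          ((IsUltrametricDist.norm_add_le_max s r).trans (max_le hs hr))]
      · have : ‖s + r‖ = ‖s‖ := by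
          rw [IsUltrametricDist.norm_add_eq_max_of_norm_ne_norm (hr.trans_lt hs).ne',
            max_eq_left (hr.trans hs.le)]
        rw [unitBallIndicator_of_lt hs, unitBallIndicator_of_lt (this ▸ hs)]
    simp [this]
  · have : r ≠ 0 := norm_pos_iff.1 (zero_lt_one.trans hr)
    rw [cutoffInv_of_lt hr]
    field_simp

theorem cutoffInv_add_sub (s r : 𝕜) :
    cutoffInv (s + r) - cutoffInv s =
      r * (cutoffInv r * (cutoffInv (s + r) * unitBallIndicator s
        - cutoffInv s * unitBallIndicator (s + r)) - cutoffInv s * cutoffInv (s + r)) := by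
  have ne : ∀ {x : 𝕜}, 1 < ‖x‖ → x ≠ 0 := fun h => norm_pos_iff.1 (zero_lt_one.trans h)
  rcases le_or_gt ‖s‖ 1 with hs | hs <;> rcases le_or_gt ‖s + r‖ 1 with hsr | hsr
  · simp [cutoffInv_of_le hs, cutoffInv_of_le hsr]
  · have hr : 1 < ‖r‖ := by
      by_contra! hr
      exact hsr.not_ge ((IsUltrametricDist.norm_add_le_max s r).trans (max_le hs hr))
    have := ne hr
    rw [cutoffInv_of_le hs, cutoffInv_of_lt hsr, cutoffInv_of_lt hr, unitBallIndicator_of_le hs]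
    field_simp
    ring
  · have hr : 1 < ‖r‖ := by
      by_contra! hr
      have := IsUltrametricDist.norm_add_le_max (s + r) (-r)
      rw [add_neg_cancel_right, norm_neg] at this
      exact hs.not_ge (this.trans (max_le hsr hr))
    have := ne hr
    rw [cutoffInv_of_lt hs, cutoffInv_of_le hsr, cutoffInv_of_lt hr, unitBallIndicator_of_le hsr]
    field_simp
    ring
  · have h1 := ne hs
    have h2 := ne hsr
    rw [cutoffInv_of_lt hs, cutoffInv_of_lt hsr, unitBallIndicator_of_lt hs,
      unitBallIndicator_of_lt hsr]
    field_simp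
    ring

namespace UltraNice

theorem continuous {D : Type v} [NormedAddCommGroup D] [NormedSpace 𝕜 D] {f : D → 𝕜}
    (hf : UltraNice f) : Continuous f := by
  induction hf with
  | const c => exact continuous_const
  | linear L => exact L.continuous
  | add _ _ h1 h2 => exact Continuous.add h1 h2
  | mul _ _ h1 h2 => exact Continuous.mul h1 h2
  | indicator _ h => exact continuous_unitBallIndicator.comp h
  | inv _ h => exact continuous_cutoffInv.comp h

theorem exists_diffQuot {D : Type v} [NormedAddCommGroup D] [NormedSpace 𝕜 D] {f : D → 𝕜}
    (hf : UltraNice f) : ∃ g : D × D × 𝕜 → 𝕜, IsDiffQuot univ f g ∧ UltraNice g := by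
  have base : ∀ {D : Type v} [NormedAddCommGroup D] [NormedSpace 𝕜 D] {f : D → 𝕜},
      UltraNice f → UltraNice fun p : D × D × 𝕜 => f p.1 := fun {D} _ _ _ hf =>
    hf.comp_clm (ContinuousLinearMap.fst 𝕜 D (D × 𝕜))
  have scal : ∀ {D : Type v} [NormedAddCommGroup D] [NormedSpace 𝕜 D],
      UltraNice fun p : D × D × 𝕜 => p.2.2 := fun {D} _ _ =>
    .linear (ContinuousLinearMap.snd 𝕜 D 𝕜 ∘L ContinuousLinearMap.snd 𝕜 D (D × 𝕜))
  have shift : ∀ {D : Type v} [NormedAddCommGroup D] [NormedSpace 𝕜 D] {f : D → 𝕜}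
      {g : D × D × 𝕜 → 𝕜}, IsDiffQuot univ f g → ∀ x y : D, ∀ t : 𝕜,
      f (x + t • y) = f x + t * g (x, y, t) := fun h x y t => by
    have := h x y t (by simp)
    rw [smul_eq_mul] at this
    rw [← this, add_sub_cancel]
  induction hf with
  | const c => exact ⟨fun _ => 0, fun _ _ _ _ => by simp, .const 0⟩
  | linear L =>
    exact ⟨_, fun x y t _ => by simp, .linear
      (L ∘L ContinuousLinearMap.fst 𝕜 D 𝕜 ∘L ContinuousLinearMap.snd 𝕜 D (D × 𝕜))⟩
  | add _ _ h1 h2 =>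
    obtain ⟨f', hf', nf'⟩ := h1
    obtain ⟨g', hg', ng'⟩ := h2
    refine ⟨_, fun x y t _ => ?_, nf'.add ng'⟩
    dsimp only
    rw [shift hf', shift hg', smul_eq_mul]
    ring
  | mul nf ng h1 h2 =>
    obtain ⟨f', hf', nf'⟩ := h1
    obtain ⟨g', hg', ng'⟩ := h2
    refine ⟨_, fun x y t _ => ?_,
      (nf'.mul (base ng)).add (((base nf).add (scal.mul nf')).mul ng')⟩
    dsimp only
    rw [shift hf', shift hg', smul_eq_mul]
    ring
  | indicator nf h =>
    obtain ⟨f', hf', nf'⟩ := h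
    have nr := scal.mul nf'
    refine ⟨_, fun x y t _ => ?_,
      nf'.mul ((((base nf).add nr).indicator.sub (base nf).indicator).mul nr.inv)⟩
    dsimp only
    rw [shift hf']
    exact (unitBallIndicator_add_sub _ _).trans (by rw [smul_eq_mul, mul_assoc])
  | inv nf h =>
    obtain ⟨f', hf', nf'⟩ := h
    have nr := scal.mul nf'
    have ns := (base nf).add nr
    refine ⟨_, fun x y t _ => ?_,
      nf'.mul ((nr.inv.mul ((ns.inv.mul (base nf).indicator).sub
        ((base nf).inv.mul ns.indicator))).sub ((base nf).inv.mul ns.inv))⟩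
    dsimp only
    rw [shift hf', cutoffInv_add_sub, smul_eq_mul, mul_assoc]

end UltraNice

/-- The bump calculus over an ultrametric field, with the indicator function of the closed unit
ball as bump function. -/
noncomputable def ultrametricBumpCalculus (𝕜 : Type v) [NontriviallyNormedField 𝕜]
    [IsUltrametricDist 𝕜] : BumpCalculus 𝕜 where
  nice := UltraNice
  continuous := UltraNice.continuous
  bounded := UltraNice.bounded
  diffQuot := UltraNice.exists_diffQuot
  bump := unitBallIndicator
  nice_bump a b := ((UltraNice.linear (ContinuousLinearMap.mul 𝕜 𝕜 a)).add (.const b)).indicator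
  bump_eq_one _ ht := unitBallIndicator_of_le ht
  bump_eq_zero _ ht := unitBallIndicator_of_lt (one_lt_two.trans_le ht)
  norm_bump_le := norm_unitBallIndicator_le

end Ultrametric

theorem theorem12p4 :
    -- the case of the real field
    (∀ (E : Type u) [AddCommGroup E] [Module ℝ E] [TopologicalSpace E]
        [IsTopologicalAddGroup E] [ContinuousSMul ℝ E] [MetrizableSpace E]
        (F : Type w) [AddCommGroup F] [Module ℝ F] [TopologicalSpace F]
        [IsTopologicalAddGroup F] [ContinuousSMul ℝ F] [T2Space F]
        (U : Set E) (_ : IsOpen U) (f : E → F),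
      (∀ k : ℕ, IsCk.{u, 0, w} ℝ k U f ↔
        ∀ c : (Fin (k + 1) → ℝ) → E, IsSmoothMap.{0, 0, u} ℝ Set.univ c → (∀ s, c s ∈ U) →
          IsCk.{0, 0, w} ℝ k Set.univ (f ∘ c)) ∧
      (IsSmoothMap.{u, 0, w} ℝ U f ↔
        ∀ k : ℕ, 1 ≤ k → ∀ c : (Fin k → ℝ) → E, IsSmoothMap.{0, 0, u} ℝ Set.univ c →
          (∀ s, c s ∈ U) → IsSmoothMap.{0, 0, w} ℝ Set.univ (f ∘ c))) ∧
    -- the case of an arbitrary (not necessarily complete) ultrametric field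
    (∀ (𝕜 : Type v) [NontriviallyNormedField 𝕜] [IsUltrametricDist 𝕜]
        (E : Type (max u v)) [AddCommGroup E] [Module 𝕜 E] [TopologicalSpace E]
        [IsTopologicalAddGroup E] [ContinuousSMul 𝕜 E] [MetrizableSpace E]
        (F : Type w) [AddCommGroup F] [Module 𝕜 F] [TopologicalSpace F]
        [IsTopologicalAddGroup F] [ContinuousSMul 𝕜 F] [T2Space F]
        (U : Set E) (_ : IsOpen U) (f : E → F),
      (∀ k : ℕ, IsCk.{u, v, w} 𝕜 k U f ↔
        ∀ c : (Fin (k + 1) → 𝕜) → E, IsSmoothMap.{0, v, max u v} 𝕜 Set.univ c →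
          (∀ s, c s ∈ U) → IsCk.{0, v, w} 𝕜 k Set.univ (f ∘ c)) ∧
      (IsSmoothMap.{u, v, w} 𝕜 U f ↔
        ∀ k : ℕ, 1 ≤ k → ∀ c : (Fin k → 𝕜) → E, IsSmoothMap.{0, v, max u v} 𝕜 Set.univ c →
          (∀ s, c s ∈ U) → IsSmoothMap.{0, v, w} 𝕜 Set.univ (f ∘ c))) := by
  exact ⟨fun E _ _ _ _ _ _ F _ _ _ _ _ _ U hU f =>
      realBumpCalculus.isCk_iff_and_isSmoothMap_iff.{u, 0, w} hU f,
    fun 𝕜 _ _ E _ _ _ _ _ _ F _ _ _ _ _ _ U hU f =>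
      (ultrametricBumpCalculus 𝕜).isCk_iff_and_isSmoothMap_iff.{u, v, w} hU f⟩
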